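/- Let $f$ be a real function with $f(u)\to 0$ as $u\to\infty$ which for sufficiently large $u$ is $C^{1}$, decreasing and strictly convex, and suppose $1/u=o(f(u))$ as $u\to\infty$. Suppose further that either $f$ is regularly varying of index $-\alpha$ for some $0<\alpha\le 1$, i.e. $f(\lambda u)/f(u)\to\lambda^{-\alpha}$ as $u\to\infty$ for every $\lambda>0$, or that $f$ is slowly varying, i.e. $f(\lambda u)/f(u)\to 1$ for every $\lambda>0$, and satisfies $$\limsup_{u\to\infty}\frac{|f'((1+\delta)u)|}{|f'(u)|}<1\qquad\text{for every }\delta>0 .$$ A Beurling number system in the extended sense is a pair $\mathcal B=(\Pi,N)$ of right-continuous non-decreasing functions supported on $[1,\infty)$ with $\Pi(1)=0$, $N(1)=1$ and $dN=\sum_{n\ge 0}(d\Pi)^{*n}/n!$, where $*$ is multiplicative convolution of measures and $(d\Pi)^{*0}$ is the unit point mass at $1$. Its Beurling zeta function is $\zeta_{\mathcal B}(s)=\int_{1^-}^{\infty}x^{-s}\,dN(x)$. Write $s=\sigma+it$. Then there exist a Beurling number system in the extended sense $\mathcal B$, non-decreasing functions $\varphi,\psi$ on $[0,\infty)$ with $\varphi>0$,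 $\varphi(t)\to\infty$ and $\psi\ge 1$, and a number $t_0>0$ such that the following hold. 1. The integrals $\int_{1^-}^\infty x^{-\sigma}\,dN(x)$ and $\int_{1^-}^\infty x^{-\sigma}\,d\Pi(x)$ converge for $\sigma>1$, we have $\zeta_{\mathcal B}(s)=\exp\int_{1^-}^\infty x^{-s}\,d\Pi(x)$ for $\sigma>1$, and $\zeta_{\mathcal B}$ has an analytic continuation to the region $\sigma\ge 1-1/\psi(|t|)$, with the exception of a simple pole at $s=1$. 2. $\psi(t)\ll e^{\varphi(t)}$ for $t\ge t_0$, and $\zeta_{\mathcal B}(s)\ll e^{\varphi(t)}$ for $\sigma\ge 1-1/\psi(t)$, $t\ge t_0$. (So $\zeta_{\mathcal B}$, $\varphi$, $\psi$ satisfy all hypotheses of Landau's Hauptsatz, whose conclusion is that for some constant $c>0$ there are no zeros with $\sigma\ge 1-\frac{c}{\psi(2t+1)\varphi(2t+1)}$, $t\ge t_0$.) 3. $\zeta_{\mathcal B}$ has infinitely many zeros in the region $\sigma\ge 1-f(\log t)$; more precisely, for every $T$ it has infinitely many such zeros with $t\ge T$, lying in the region $\sigma\ge 1-1/\psi(|t|)$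 of item 1. 4. As $t\to\infty$, $$\frac{1}{\psi(2t+1)\varphi(2t+1)}\ \ge\ \frac{f(\log t)}{2+o(1)} .$$ Hence Landau's method is sharp up to the value of the constant: for this $\zeta_{\mathcal B}$, $\varphi$, $\psi$, for every $c>2$ and every $T$ there is a zero of $\zeta_{\mathcal B}$ with $t\ge T$ in the region where both $\sigma\ge 1-1/\psi(|t|)$ and $\sigma\ge 1-\frac{c}{\psi(2t+1)\varphi(2t+1)}$. -/

import Mathlib

open Filter Topology MeasureTheory Set Asymptotics

noncomputable section

/-! ### Conditions on the function `f` -/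

/-- For all sufficiently large `u`, the function `f` is `C¹`, decreasing and strictly convex. -/
def EventuallyNice (f : ℝ → ℝ) : Prop :=
  ∃ U : ℝ, ContDiffOn ℝ 1 f (Ici U) ∧ AntitoneOn f (Ici U) ∧ StrictConvexOn ℝ (Ici U) f

/-- `f` is regularly varying (at infinity) of index `ρ`. -/
def RegularlyVarying (f : ℝ → ℝ) (ρ : ℝ) : Prop :=
  ∀ l : ℝ, 0 < l → Tendsto (fun u => f (l * u) / f u) atTop (𝓝 (l ^ ρ))

/-- `f` is slowly varying (at infinity). -/
def SlowlyVarying (f : ℝ → ℝ) : Prop :=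
  ∀ l : ℝ, 0 < l → Tendsto (fun u => f (l * u) / f u) atTop (𝓝 1)

/-- For all `δ > 0`, `limsup |f'((1 + δ) u)| / |f'(u)| < 1` as `u → ∞`. (For a function that
satisfies `EventuallyNice` and tends to `0`, these quotients eventually lie in `[0, 1]`, so that
the real-valued `limsup` is the true one.) -/
def DerivDecrease (f : ℝ → ℝ) : Prop :=
  ∀ δ : ℝ, 0 < δ → limsup (fun u => |deriv f ((1 + δ) * u)| / |deriv f u|) atTop < 1

/-! ### Beurling number systems in the extended sense -/

/-- The `n`-th power of a measure on `ℝ` for multiplicative convolution; the zeroth power is the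
unit point mass at `1`. -/
def mulConvPow (μ : Measure ℝ) : ℕ → Measure ℝ
  | 0 => Measure.dirac 1
  | n + 1 => Measure.mconv (mulConvPow μ n) μ

/-- The exponential `∑ μ^{*n} / n!` of a measure on `ℝ` for multiplicative convolution. -/
def mulConvExp (μ : Measure ℝ) : Measure ℝ :=
  Measure.sum fun n : ℕ => ((n.factorial : ENNReal)⁻¹) • mulConvPow μ n

/-- A Beurling number system in the extended sense: a pair `(Π, N)` of right-continuous
non-decreasing functions supported on `[1, ∞)` with `Π(1) = 0`, `N(1) = 1` and
`dN = exp*(dΠ)`. -/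
structure ExtendedBeurlingSystem where
  /-- The function `Π`. -/
  primeFn : StieltjesFunction ℝ
  /-- The function `N`. -/
  intFn : StieltjesFunction ℝ
  primeFn_of_lt : ∀ x < 1, primeFn x = 0
  primeFn_one : primeFn 1 = 0
  intFn_of_lt : ∀ x < 1, intFn x = 0
  intFn_one : intFn 1 = 1
  measure_intFn : intFn.measure = mulConvExp primeFn.measure

/-- The integral `∫_{1⁻}^∞ x^{-s} dm(x)`. -/
def mellinStieltjes (m : Measure ℝ) (s : ℂ) : ℂ :=
  ∫ x in Ici (1 : ℝ), (x : ℂ) ^ (-s) ∂m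

/-- The integral `∫_{1⁻}^∞ x^{-σ} dm(x)` converges for all real `σ > 1`. -/
def MellinStieltjesConvergent (m : Measure ℝ) : Prop :=
  ∀ σ : ℝ, 1 < σ → IntegrableOn (fun x : ℝ => x ^ (-σ)) (Ici 1) m

/-- The Beurling zeta function `∫_{1⁻}^∞ x^{-s} dN(x)` of a system in the extended sense, in its
half-plane of absolute convergence. -/
def ExtendedBeurlingSystem.zeta (B : ExtendedBeurlingSystem) (s : ℂ) : ℂ :=
  mellinStieltjes B.intFn.measure s

/-! ### Landau's Hauptsatz -/

/-- The closed region `σ ≥ 1 - 1 / ψ(|t|)`, where `s = σ + i t`. -/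
def landauRegion (ψ : ℝ → ℝ) : Set ℂ :=
  {s : ℂ | 1 - 1 / ψ |s.im| ≤ s.re}

/-- The hypotheses of Landau's Hauptsatz for the measure `m`, the function `F` and the functions
`φ`, `ψ`, with the bound on `F` holding for `t ≥ t₀`. The functions `φ`, `ψ` are taken to be
defined and non-decreasing on all of `[0, ∞)`, so that the region `σ ≥ 1 - 1 / ψ(|t|)` makes
sense for all real `t`. -/
structure LandauHypotheses (m : Measure ℝ) (F : ℂ → ℂ) (φ ψ : ℝ → ℝ) (t₀ : ℝ) : Prop where
  t₀_pos : 0 < t₀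
  φ_mono : MonotoneOn φ (Ici 0)
  φ_pos : ∀ t, 0 ≤ t → 0 < φ t
  φ_tendsto : Tendsto φ atTop atTop
  ψ_mono : MonotoneOn ψ (Ici 0)
  one_le_ψ : ∀ t, 0 ≤ t → 1 ≤ ψ t
  ψ_bound : ∃ C : ℝ, ∀ t, t₀ ≤ t → ψ t ≤ C * Real.exp (φ t)
  m_support : m (Iio 1) = 0
  m_convergent : MellinStieltjesConvergent m
  F_eq_exp : ∀ s : ℂ, 1 < s.re → F s = Complex.exp (mellinStieltjes m s)
  F_analytic : AnalyticOnNhd ℂ F (landauRegion ψ \ {1})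
  F_pole : meromorphicOrderAt F 1 = -1
  F_bound : ∃ C : ℝ, ∀ s : ℂ, t₀ ≤ s.im → 1 - 1 / ψ s.im ≤ s.re →
    ‖F s‖ ≤ C * Real.exp (φ s.im)

/-- The constant `c` is admissible in the conclusion of Landau's Hauptsatz for `F`, `φ`, `ψ`:
`F(s) ≠ 0` for `σ ≥ 1 - c / (ψ(2t+1) φ(2t+1))` and all sufficiently large `t`
(where `s = σ + i t` runs over the region on which `F` is given). -/
def LandauAdmissible (F : ℂ → ℂ) (φ ψ : ℝ → ℝ) (c : ℝ) : Prop :=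
  ∃ T : ℝ, ∀ s ∈ landauRegion ψ, T ≤ s.im →
    1 - c / (ψ (2 * s.im + 1) * φ (2 * s.im + 1)) ≤ s.re → F s ≠ 0

end

/-!
The system is prescribed through its zeta function. Fix a very sparse sequence of heights `t n`, put
`l n = 1 / f (log (t n))` and `ρ n = 1 - 1 / l n + i t n`, and let

`Z s = s / (s - 1) * ∏ G (l n (s - ρ n)) * ∏ G (l n (s - conj (ρ n)))`,
where `G z = 1 - ∫_1^2 e^{-zv} dv`.

The entire function `G` vanishes at `0`, so that `Z` has the zeros `ρ n`, which lie on the curve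
`σ = 1 - f (log t)`. This construction goes back to Diamond, Montgomery and Vorhauer.

*Positivity.* For `Re z > 0`, `G z` is the exponential of minus the Laplace transform of
`g = ∑ χ^{*n} / n`, with `χ` the indicator function of `(1, 2]` (`exp_neg_integral_logKernel`).
Hence for `σ > 1` the function `Z` is the exponential of the Mellin transform of a signed measure
with an explicit density (`IsSparse.exp_integral_primeDensity`): the main term `(e^v - 1) / v` in
`v = log x`, which accounts for `s / (s - 1)`, minus one oscillating term for each zero. The renewal
bound `∑ χ^{*n} ≤ 1` gives `0 ≤ g ≤ 1`, and `g` vanishes on `(-∞, 1]`. With `y = v / l n`, the term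
of `ρ n` is therefore at most `2 y e^{-y} e^v / v`, and it vanishes for `y ≤ 1`. As
`2 y e^{-y} ≤ 2 / e < 1`, and as sparsity makes all but one of the terms negligible at any `v`, the
density is nonnegative (`IsSparse.primeDensity_nonneg`). Every measure on `(1, ∞)` with finite
Mellin transforms for `σ > 1` is the `dΠ` of a Beurling system in the extended sense, with zeta
function `exp ∫ x^{-s} dΠ` (`exists_extendedBeurlingSystem`).

*Growth.* Since `1 / u = o(f u)`, `l n` is small compared with `log (t n)`, and a factor of `Z` is
`1 + O(4^{-n})` at all heights that are not comparable with `t n`. At height `t` at most one factor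
remains, and for `σ ≥ 1 - 1 / ψ t` it is at most `1 + e^{2 l n / ψ t}`
(`IsSparse.norm_continuedZeta_le`). So the growth condition holds when `φ ψ ≥ 2 l n` at all heights
comparable with `t n`. The choice `φ t = ψ t = √(2 / f (log 2t))` for large `t` meets it, and then
`1 / (φ ψ)` at `2 t + 1` is `f (log (4 t + 2)) / 2`, which is asymptotic to `f (log t) / 2` because
`f` is regularly or slowly varying (`tendsto_ratio`).
-/

/-! ### Beurling systems generated by a measure -/

/-- The Stieltjes function `x ↦ μ (-∞, x]` of a measure that is finite on every half-line
`(-∞, x]`. -/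
noncomputable def distributionFunction (μ : Measure ℝ) (hμ : ∀ x, μ (Iic x) ≠ ⊤) :
    StieltjesFunction ℝ where
  toFun x := (μ (Iic x)).toReal
  mono' x y hxy := ENNReal.toReal_mono (hμ y) (measure_mono (Iic_subset_Iic.2 hxy))
  right_continuous' x := by
    rw [← continuousWithinAt_Ioi_iff_Ici]
    have hinter : ⋂ r > x, Iic r = Iic x := by
      ext y
      simp only [mem_iInter, mem_Iic]
      exact ⟨fun h => le_of_forall_gt_imp_ge_of_dense h, fun h r hr => h.trans hr.le⟩
    have h := tendsto_measure_biInter_gt (μ := μ) (s := fun r => Iic r) (a := x)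
      (fun r _ => measurableSet_Iic.nullMeasurableSet)
      (fun i j _ hij => Iic_subset_Iic.2 hij) ⟨x + 1, by simp, hμ _⟩
    rw [hinter] at h
    exact (ENNReal.tendsto_toReal (hμ x)).comp h

lemma distributionFunction_measure (μ : Measure ℝ) (hμ : ∀ x, μ (Iic x) ≠ ⊤) :
    (distributionFunction μ hμ).measure = μ := by
  refine Measure.ext_of_Ioc _ _ fun a b hab => ?_
  rw [StieltjesFunction.measure_Ioc]
  change ENNReal.ofReal ((μ (Iic b)).toReal - (μ (Iic a)).toReal) = _
  rw [← Iic_sdiff_Iic, measure_sdiff (Iic_subset_Iic.2 hab.le) measurableSet_Iic.nullMeasurableSet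
    (hμ a), ENNReal.ofReal_sub _ ENNReal.toReal_nonneg, ENNReal.ofReal_toReal (hμ a),
    ENNReal.ofReal_toReal (hμ b)]

lemma mulConvPow_Iio_one (μ : Measure ℝ) [SFinite μ] (hμ : μ (Iio 1) = 0) (n : ℕ) :
    SFinite (mulConvPow μ n) ∧ mulConvPow μ n (Iio 1) = 0 := by
  induction n with
  | zero => exact ⟨by unfold mulConvPow; infer_instance, by simp [mulConvPow]⟩
  | succ n ih =>
    obtain ⟨h1, h2⟩ := ih
    refine ⟨by unfold mulConvPow; infer_instance, ?_⟩
    rw [mulConvPow, Measure.mconv, Measure.map_apply measurable_mul measurableSet_Iio]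
    refine measure_mono_null (t := Iio 1 ×ˢ univ ∪ univ ×ˢ Iio 1) ?_ ?_
    · rintro ⟨x, y⟩ hxy
      simp only [mem_preimage, mem_Iio] at hxy
      by_contra hcon
      simp only [mem_union, mem_prod, mem_Iio, mem_univ, and_true, true_and, not_or,
        not_lt] at hcon
      nlinarith [hcon.1, hcon.2]
    · rw [measure_union_null_iff]
      simp [Measure.prod_prod, h2, hμ]

lemma mulConvPow_succ_Iic_one (μ : Measure ℝ) [SFinite μ] (hμ : μ (Iic 1) = 0) (n : ℕ) :
    mulConvPow μ (n + 1) (Iic 1) = 0 := by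
  have hμ' : μ (Iio 1) = 0 := measure_mono_null Iio_subset_Iic_self hμ
  obtain ⟨h1, h2⟩ := mulConvPow_Iio_one μ hμ' n
  rw [mulConvPow, Measure.mconv, Measure.map_apply measurable_mul measurableSet_Iic]
  refine measure_mono_null (t := Iio 1 ×ˢ univ ∪ univ ×ˢ Iic 1) ?_ ?_
  · rintro ⟨x, y⟩ hxy
    simp only [mem_preimage, mem_Iic] at hxy
    by_contra hcon
    simp only [mem_union, mem_prod, mem_Iio, mem_Iic, mem_univ, and_true, true_and, not_or,
      not_lt, not_le] at hcon
    nlinarith [hcon.1, hcon.2]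
  · rw [measure_union_null_iff]
    simp [Measure.prod_prod, h2, hμ]

lemma ae_one_le_of_Iio {μ : Measure ℝ} (hμ : μ (Iio 1) = 0) : ∀ᵐ x ∂μ, 1 ≤ x := by
  rw [ae_iff]; simpa [Iio] using hμ

lemma mulConvExp_Iio_one (μ : Measure ℝ) [SFinite μ] (hμ : μ (Iio 1) = 0) :
    mulConvExp μ (Iio 1) = 0 := by
  rw [mulConvExp, Measure.sum_apply _ measurableSet_Iio]
  simp [(mulConvPow_Iio_one μ hμ _).2]

lemma mulConvExp_Iic_one (μ : Measure ℝ) [SFinite μ] (hμ : μ (Iic 1) = 0) :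
    mulConvExp μ (Iic 1) = 1 := by
  rw [mulConvExp, Measure.sum_apply _ measurableSet_Iic, tsum_eq_single 0]
  · simp [mulConvPow]
  · intro n hn
    obtain ⟨m, rfl⟩ := Nat.exists_eq_succ_of_ne_zero hn
    simp [mulConvPow_succ_Iic_one μ hμ]

lemma lintegral_rpow_mulConvPow (μ : Measure ℝ) [SFinite μ] (hμ : μ (Iio 1) = 0) (σ : ℝ) (n : ℕ) :
    ∫⁻ x, ENNReal.ofReal (x ^ (-σ)) ∂(mulConvPow μ n) =
      (∫⁻ x, ENNReal.ofReal (x ^ (-σ)) ∂μ) ^ n := by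
  induction n with
  | zero => simp [mulConvPow]
  | succ n ih =>
    obtain ⟨h1, h2⟩ := mulConvPow_Iio_one μ hμ n
    have hm : Measurable fun x : ℝ => ENNReal.ofReal (x ^ (-σ)) := by fun_prop
    rw [mulConvPow, Measure.lintegral_mconv hm, pow_succ, ← ih,
      ← lintegral_mul_const _ hm]
    refine lintegral_congr_ae ?_
    filter_upwards [ae_one_le_of_Iio h2] with x hx
    rw [← lintegral_const_mul _ hm]
    refine lintegral_congr_ae ?_
    filter_upwards [ae_one_le_of_Iio hμ] with y hy
    rw [Real.mul_rpow (by linarith) (by linarith), ENNReal.ofReal_mul (by positivity)]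

lemma lintegral_rpow_mulConvExp_ne_top (μ : Measure ℝ) [SFinite μ] (hμ : μ (Iio 1) = 0) (σ : ℝ)
    (hfin : ∫⁻ x, ENNReal.ofReal (x ^ (-σ)) ∂μ ≠ ⊤) :
    ∫⁻ x, ENNReal.ofReal (x ^ (-σ)) ∂(mulConvExp μ) ≠ ⊤ := by
  rw [mulConvExp, lintegral_sum_measure]
  simp_rw [lintegral_smul_measure, lintegral_rpow_mulConvPow μ hμ]
  lift (∫⁻ x, ENNReal.ofReal (x ^ (-σ)) ∂μ) to NNReal using hfin with A
  have h : Summable fun n : ℕ => ((n.factorial : NNReal)⁻¹ * A ^ n) := by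
    rw [← NNReal.summable_coe]
    simpa [div_eq_inv_mul] using Real.summable_pow_div_factorial (A : ℝ)
  convert ENNReal.tsum_coe_ne_top_iff_summable.2 h using 3 with n
  rw [ENNReal.coe_mul, ENNReal.coe_inv (by positivity)]
  simp

lemma integrable_cpow_of_rpow {μ : Measure ℝ} (hμ : μ (Iio 1) = 0) {s : ℂ}
    (hfin : ∫⁻ x, ENNReal.ofReal (x ^ (-s.re)) ∂μ ≠ ⊤) :
    Integrable (fun x : ℝ => (x : ℂ) ^ (-s)) μ := by
  refine ⟨(Complex.measurable_ofReal.pow_const _).aestronglyMeasurable, ?_⟩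
  rw [HasFiniteIntegral]
  refine lt_of_le_of_lt (le_of_eq ?_) hfin.lt_top
  refine lintegral_congr_ae ?_
  filter_upwards [ae_one_le_of_Iio hμ] with x hx
  rw [← ofReal_norm, Complex.norm_cpow_eq_rpow_re_of_pos (by linarith)]
  simp

lemma integral_cpow_mulConvPow (μ : Measure ℝ) [SFinite μ] (hμ : μ (Iio 1) = 0) (s : ℂ)
    (hfin : ∫⁻ x, ENNReal.ofReal (x ^ (-s.re)) ∂μ ≠ ⊤) (n : ℕ) :
    ∫ x : ℝ, (x : ℂ) ^ (-s) ∂(mulConvPow μ n) = (∫ x : ℝ, (x : ℂ) ^ (-s) ∂μ) ^ n := by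
  induction n with
  | zero => simp [mulConvPow]
  | succ n ih =>
    obtain ⟨h1, h2⟩ := mulConvPow_Iio_one μ hμ n
    have hint : Integrable (fun x : ℝ => (x : ℂ) ^ (-s)) (mulConvPow μ (n + 1)) := by
      refine integrable_cpow_of_rpow (mulConvPow_Iio_one μ hμ (n + 1)).2 ?_
      rw [lintegral_rpow_mulConvPow μ hμ]
      exact ENNReal.pow_ne_top hfin
    rw [mulConvPow] at hint ⊢
    rw [integral_mconv hint, pow_succ, ← ih, ← integral_mul_const]
    refine integral_congr_ae ?_
    filter_upwards [ae_one_le_of_Iio h2] with x hx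
    rw [← integral_const_mul]
    refine integral_congr_ae ?_
    filter_upwards [ae_one_le_of_Iio hμ] with y hy
    rw [Complex.ofReal_mul, Complex.mul_cpow_ofReal_nonneg (by linarith) (by linarith)]

/-- The Mellin–Stieltjes transform turns the convolution exponential into the exponential. -/
lemma integral_cpow_mulConvExp (μ : Measure ℝ) [SFinite μ] (hμ : μ (Iio 1) = 0) (s : ℂ)
    (hfin : ∫⁻ x, ENNReal.ofReal (x ^ (-s.re)) ∂μ ≠ ⊤) :
    ∫ x : ℝ, (x : ℂ) ^ (-s) ∂(mulConvExp μ) = Complex.exp (∫ x : ℝ, (x : ℂ) ^ (-s) ∂μ) := by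
  have hint : Integrable (fun x : ℝ => (x : ℂ) ^ (-s)) (mulConvExp μ) :=
    integrable_cpow_of_rpow (mulConvExp_Iio_one μ hμ)
      (lintegral_rpow_mulConvExp_ne_top μ hμ _ hfin)
  have h1 := hasSum_integral_measure hint
  have h2 := NormedSpace.expSeries_div_hasSum_exp (∫ x : ℝ, (x : ℂ) ^ (-s) ∂μ)
  rw [← Complex.exp_eq_exp_ℂ] at h2
  refine h1.unique ?_
  have h3 : (fun n : ℕ => ∫ x : ℝ, (x : ℂ) ^ (-s)
      ∂((n.factorial : ENNReal)⁻¹ • mulConvPow μ n)) =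
      fun n : ℕ => (∫ x : ℝ, (x : ℂ) ^ (-s) ∂μ) ^ n / (n.factorial : ℂ) := by
    funext n
    rw [integral_smul_measure, integral_cpow_mulConvPow μ hμ s hfin]
    simp [div_eq_inv_mul]
  rw [h3]
  exact h2

lemma restrict_Ici_one_eq {μ : Measure ℝ} (hμ : μ (Iio 1) = 0) : μ.restrict (Ici 1) = μ :=
  Measure.restrict_eq_self_of_ae_mem (ae_one_le_of_Iio hμ)

lemma Iic_ne_top_of_lintegral_rpow {μ : Measure ℝ} (hμ : μ (Iio 1) = 0)
    (hfin : ∫⁻ x, ENNReal.ofReal (x ^ (-2 : ℝ)) ∂μ ≠ ⊤) (x : ℝ) : μ (Iic x) ≠ ⊤ := by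
  rcases lt_or_ge x 1 with hx | hx
  · rw [measure_mono_null (Iic_subset_Iio.2 hx) hμ]; simp
  have hpos : 0 < x ^ (-2 : ℝ) := Real.rpow_pos_of_pos (by linarith) _
  have h1 : ENNReal.ofReal (x ^ (-2 : ℝ)) * μ (Iic x) ≤
      ∫⁻ y, ENNReal.ofReal (y ^ (-2 : ℝ)) ∂μ := by
    rw [← setLIntegral_const]
    refine (setLIntegral_mono_ae (by fun_prop) ?_).trans (setLIntegral_le_lintegral _ _)
    filter_upwards [ae_one_le_of_Iio hμ] with y hy hyx
    exact ENNReal.ofReal_le_ofReal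
      (Real.rpow_le_rpow_of_nonpos (by linarith) hyx (by norm_num))
  intro htop
  rw [htop, ENNReal.mul_top (ENNReal.ofReal_pos.2 hpos).ne'] at h1
  exact hfin (top_le_iff.1 h1)

/-- Every measure on `(1, ∞)` with finite Mellin transform for `σ > 1` is the measure `dΠ` of a
Beurling number system in the extended sense, and its zeta function is the exponential of the
Mellin transform of `dΠ`. -/
theorem exists_extendedBeurlingSystem (μ : Measure ℝ) [SFinite μ] (hμ : μ (Iic 1) = 0)
    (hfin : ∀ σ : ℝ, 1 < σ → ∫⁻ x, ENNReal.ofReal (x ^ (-σ)) ∂μ ≠ ⊤) :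
    ∃ B : ExtendedBeurlingSystem, B.primeFn.measure = μ ∧
      MellinStieltjesConvergent μ ∧ MellinStieltjesConvergent B.intFn.measure ∧
      ∀ s : ℂ, 1 < s.re → B.zeta s = Complex.exp (mellinStieltjes μ s) := by
  have hμ' : μ (Iio 1) = 0 := measure_mono_null Iio_subset_Iic_self hμ
  have hE := mulConvExp_Iio_one μ hμ'
  have hfinE := fun σ hσ => lintegral_rpow_mulConvExp_ne_top μ hμ' σ (hfin σ hσ)
  have conv : ∀ ν : Measure ℝ, ν (Iio 1) = 0 →
      (∀ σ : ℝ, 1 < σ → ∫⁻ x, ENNReal.ofReal (x ^ (-σ)) ∂ν ≠ ⊤) →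
      MellinStieltjesConvergent ν := by
    intro ν hν hν' σ hσ
    rw [IntegrableOn, restrict_Ici_one_eq hν]
    refine ⟨by fun_prop, ?_⟩
    rw [hasFiniteIntegral_iff_ofReal]
    · exact (hν' σ hσ).lt_top
    · filter_upwards [ae_one_le_of_Iio hν] with x hx
      exact Real.rpow_nonneg (by linarith) _
  have hm1 := distributionFunction_measure μ
    (Iic_ne_top_of_lintegral_rpow hμ' (hfin 2 (by norm_num)))
  have hm2 := distributionFunction_measure (mulConvExp μ)
    (Iic_ne_top_of_lintegral_rpow hE (hfinE 2 (by norm_num)))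
  refine ⟨{
    primeFn := distributionFunction μ
      (Iic_ne_top_of_lintegral_rpow hμ' (hfin 2 (by norm_num)))
    intFn := distributionFunction (mulConvExp μ)
      (Iic_ne_top_of_lintegral_rpow hE (hfinE 2 (by norm_num)))
    primeFn_of_lt := fun x hx => by
      change (μ (Iic x)).toReal = 0
      rw [measure_mono_null (Iic_subset_Iic.2 hx.le) hμ]; simp
    primeFn_one := by change (μ (Iic 1)).toReal = 0; simp [hμ]
    intFn_of_lt := fun x hx => by
      change (mulConvExp μ (Iic x)).toReal = 0
      rw [measure_mono_null (Iic_subset_Iio.2 hx) hE]; simp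
    intFn_one := by
      change (mulConvExp μ (Iic 1)).toReal = 1
      simp [mulConvExp_Iic_one μ hμ]
    measure_intFn := by rw [hm1, hm2] }, hm1, conv μ hμ' hfin, ?_, ?_⟩
  · change MellinStieltjesConvergent (distributionFunction (mulConvExp μ)
      (Iic_ne_top_of_lintegral_rpow hE (hfinE 2 (by norm_num)))).measure
    rw [hm2]; exact conv _ hE hfinE
  · intro s hs
    change mellinStieltjes (distributionFunction (mulConvExp μ)
      (Iic_ne_top_of_lintegral_rpow hE (hfinE 2 (by norm_num)))).measure s = _
    rw [hm2, mellinStieltjes, mellinStieltjes, restrict_Ici_one_eq hE, restrict_Ici_one_eq hμ']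
    exact integral_cpow_mulConvExp μ hμ' s (hfin _ hs)

/-! ### The kernel of a single zero -/

/-- The Laplace transform `∫_1^2 e^{-zv} dv` of the indicator function of `(1, 2]`. -/
noncomputable def blockTransform (z : ℂ) : ℂ := ∫ v in (1 : ℝ)..2, Complex.exp (-z * v)

/-- The additive convolution powers of the indicator function of `(1, 2]`, the index `n` standing
for the power `n + 1`. -/
noncomputable def blockPow : ℕ → ℝ → ℝ
  | 0 => (Ioc 1 2).indicator 1
  | n + 1 => fun v => ∫ u in Ioc (1 : ℝ) 2, blockPow n (v - u)

/-- The function `g = ∑ χ^{*n} / n`, where `χ` is the indicator function of `(1, 2]`; its Laplace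
transform is `-log (1 - ∫_1^2 e^{-zv} dv)`. -/
noncomputable def logKernel (v : ℝ) : ℝ := ∑' n : ℕ, blockPow n v / (n + 1)

lemma norm_cexp_neg_mul_ofReal (z : ℂ) (v : ℝ) :
    ‖Complex.exp (-z * v)‖ = Real.exp (-z.re * v) := by
  rw [Complex.norm_exp]; simp

lemma norm_blockTransform_le_of_re_nonneg {z : ℂ} (hz : 0 ≤ z.re) :
    ‖blockTransform z‖ ≤ Real.exp (-z.re) := by
  have h := intervalIntegral.norm_integral_le_of_norm_le_const (a := (1 : ℝ)) (b := 2)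
    (f := fun v : ℝ => Complex.exp (-z * v)) (C := Real.exp (-z.re)) ?_
  · norm_num at h; simpa [blockTransform] using h
  · intro v hv
    rw [uIoc_of_le (by norm_num)] at hv
    rw [norm_cexp_neg_mul_ofReal, Real.exp_le_exp]
    nlinarith [hv.1]

lemma norm_blockTransform_le {z : ℂ} {a : ℝ} (ha : 0 ≤ a) (hz : -a ≤ z.re) :
    ‖blockTransform z‖ ≤ Real.exp (2 * a) := by
  have h := intervalIntegral.norm_integral_le_of_norm_le_const (a := (1 : ℝ)) (b := 2)
    (f := fun v : ℝ => Complex.exp (-z * v)) (C := Real.exp (2 * a)) ?_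
  · norm_num at h; simpa [blockTransform] using h
  · intro v hv
    rw [uIoc_of_le (by norm_num)] at hv
    rw [norm_cexp_neg_mul_ofReal, Real.exp_le_exp]
    nlinarith [hv.1, hv.2]

lemma blockTransform_zero : blockTransform 0 = 1 := by
  simp [blockTransform]; norm_num

lemma blockTransform_eq {z : ℂ} (hz : z ≠ 0) :
    blockTransform z = (Complex.exp (-z) - Complex.exp (-2 * z)) / z := by
  rw [blockTransform, integral_exp_mul_complex (neg_ne_zero.2 hz)]
  field_simp
  push_cast
  rw [mul_one, neg_sub, mul_comm z 2]

lemma norm_blockTransform_le_div {z : ℂ} {a : ℝ} (ha : 0 ≤ a) (hz : -a ≤ z.re) (hz0 : z ≠ 0) :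
    ‖blockTransform z‖ ≤ 2 * Real.exp (2 * a) / ‖z‖ := by
  rw [blockTransform_eq hz0, norm_div]
  gcongr
  refine (norm_sub_le _ _).trans ?_
  rw [Complex.norm_exp, Complex.norm_exp]
  have h1 : Real.exp ((-z).re) ≤ Real.exp (2 * a) := by
    rw [Real.exp_le_exp]; simp; linarith
  have h2 : Real.exp ((-2 * z).re) ≤ Real.exp (2 * a) := by
    rw [Real.exp_le_exp]; simp; linarith
  linarith

lemma differentiable_blockTransform : Differentiable ℂ blockTransform := by
  set E : ℂ → ℂ := fun z => Complex.exp (-z) - Complex.exp (-2 * z) with hE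
  have hdE : Differentiable ℂ E := by fun_prop
  have h : blockTransform = dslope E 0 := by
    funext z
    by_cases hz : z = 0
    · subst hz
      rw [blockTransform_zero, dslope_same]
      have h1 : HasDerivAt (fun z : ℂ => Complex.exp (-z)) (Complex.exp (-0) * (-1)) 0 :=
        (hasDerivAt_neg (0 : ℂ)).cexp
      have h2 : HasDerivAt (fun z : ℂ => Complex.exp (-2 * z))
          (Complex.exp (-2 * 0) * (-2 * 1)) 0 := ((hasDerivAt_id (0 : ℂ)).const_mul (-2)).cexp
      have h3 : HasDerivAt E (Complex.exp (-0) * (-1) - Complex.exp (-2 * 0) * (-2 * 1)) 0 :=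
        h1.sub h2
      rw [h3.deriv]
      norm_num
    · rw [blockTransform_eq hz, dslope_of_ne _ hz, slope_def_field]
      simp [hE]
  rw [h, ← differentiableOn_univ]
  exact (Complex.differentiableOn_dslope univ_mem).2 hdE.differentiableOn

lemma stronglyMeasurable_blockPow (n : ℕ) : StronglyMeasurable (blockPow n) := by
  induction n with
  | zero => exact (stronglyMeasurable_const (b := (1 : ℝ))).indicator measurableSet_Ioc
  | succ n ih =>
    have h : StronglyMeasurable fun p : ℝ × ℝ => blockPow n (p.1 - p.2) :=
      ih.comp_measurable (measurable_fst.sub measurable_snd)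
    exact h.integral_prod_right'

lemma blockPow_nonneg (n : ℕ) (v : ℝ) : 0 ≤ blockPow n v := by
  induction n generalizing v with
  | zero => exact indicator_nonneg (fun _ _ => zero_le_one) v
  | succ n ih => exact integral_nonneg fun u => ih _

lemma blockPow_eq_zero (n : ℕ) {v : ℝ} (hv : v ≤ n + 1) : blockPow n v = 0 := by
  induction n generalizing v with
  | zero =>
    refine indicator_of_notMem ?_ _
    simp at hv ⊢
    intro h; linarith
  | succ n ih =>
    refine setIntegral_eq_zero_of_forall_eq_zero fun u hu => ih ?_
    push_cast at hv
    linarith [hu.1]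

lemma integrable_cexp_mul_blockPow (z : ℂ) (n : ℕ) :
    Integrable (fun v : ℝ => Complex.exp (-z * v) * (blockPow n v : ℂ)) ∧
      ∫ v : ℝ, Complex.exp (-z * v) * (blockPow n v : ℂ) = blockTransform z ^ (n + 1) := by
  have hX : (fun v : ℝ => Complex.exp (-z * v) * (blockPow 0 v : ℂ)) =
      (Ioc (1 : ℝ) 2).indicator fun v : ℝ => Complex.exp (-z * v) := by
    funext v
    by_cases hv : v ∈ Ioc (1 : ℝ) 2 <;> simp [blockPow, hv]
  have hX1 : Integrable ((Ioc (1 : ℝ) 2).indicator fun v : ℝ => Complex.exp (-z * v)) := by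
    rw [integrable_indicator_iff measurableSet_Ioc]
    exact (Continuous.integrableOn_Icc (by fun_prop)).mono_set Ioc_subset_Icc_self
  have hX2 : ∫ v, (Ioc (1 : ℝ) 2).indicator (fun v : ℝ => Complex.exp (-z * v)) v =
      blockTransform z := by
    rw [integral_indicator measurableSet_Ioc, blockTransform,
      intervalIntegral.integral_of_le (by norm_num)]
  induction n with
  | zero => rw [hX, zero_add, pow_one]; exact ⟨hX1, hX2⟩
  | succ n ih =>
    have hconv : (fun v : ℝ => Complex.exp (-z * v) * (blockPow (n + 1) v : ℂ)) =
        convolution ((Ioc (1 : ℝ) 2).indicator fun v : ℝ => Complex.exp (-z * v))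
          (fun v : ℝ => Complex.exp (-z * v) * (blockPow n v : ℂ))
          (ContinuousLinearMap.mul ℝ ℂ) volume := by
      funext v
      rw [convolution_def, blockPow, ← integral_complex_ofReal, ← integral_const_mul,
        ← integral_indicator measurableSet_Ioc]
      congr 1
      funext u
      by_cases hu : u ∈ Ioc (1 : ℝ) 2
      · simp only [hu, indicator_of_mem, ContinuousLinearMap.mul_apply']
        rw [← mul_assoc, ← Complex.exp_add]
        congr 2
        push_cast
        ring
      · simp [hu]
    rw [hconv]
    refine ⟨hX1.integrable_convolution _ ih.1, ?_⟩
    rw [integral_convolution _ hX1 ih.1, hX2, ih.2]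
    simp [pow_succ']

lemma integrable_shift_blockPow (n : ℕ) (v : ℝ) :
    IntegrableOn (fun u : ℝ => blockPow n (v - u)) (Ioc 1 2) := by
  have h : Integrable (blockPow n) := by
    have := (integrable_cexp_mul_blockPow 0 n).1.norm
    refine this.congr (Eventually.of_forall fun v => ?_)
    simp [abs_of_nonneg (blockPow_nonneg n v)]
  exact (h.comp_sub_left v).integrableOn

/-- The renewal bound: at every point, the convolution powers of the indicator function of
`(1, 2]` have sum at most `1`, since this sum is an average of earlier values of itself. -/
lemma sum_blockPow_le_one (N : ℕ) (v : ℝ) : ∑ n ∈ Finset.range N, blockPow n v ≤ 1 := by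
  induction N generalizing v with
  | zero => simp
  | succ N ih =>
    have h0 : blockPow 0 v ≤ 1 := indicator_le_self' (fun _ _ => zero_le_one) v
    rw [Finset.sum_range_succ']
    rcases le_or_gt v 2 with hv | hv
    · rw [Finset.sum_eq_zero, zero_add]
      · exact h0
      · intro n _
        refine blockPow_eq_zero _ ?_
        push_cast
        have : (0 : ℝ) ≤ n := n.cast_nonneg
        linarith
    · have h1 : blockPow 0 v = 0 := indicator_of_notMem (fun h => by linarith [h.2]) _
      rw [h1, add_zero]
      simp_rw [blockPow]
      rw [← integral_finsetSum _ fun n _ => integrable_shift_blockPow n v]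
      have h2 := setIntegral_mono_on (s := Ioc (1 : ℝ) 2) (μ := volume)
        (integrable_finsetSum _ fun n _ => integrable_shift_blockPow n v)
        (integrableOn_const (C := (1 : ℝ)) (by simp)) measurableSet_Ioc
        (fun u _ => ih (v - u))
      refine h2.trans ?_
      simp; norm_num

lemma blockPow_finite_support (v : ℝ) : (Function.support fun n : ℕ => blockPow n v).Finite := by
  refine (Finset.range (⌈v⌉₊)).finite_toSet.subset fun n hn => ?_
  by_contra hcon
  refine hn (blockPow_eq_zero n ?_)
  have h1 : ⌈v⌉₊ ≤ n := by simpa using hcon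
  have h2 : (⌈v⌉₊ : ℝ) ≤ n := by exact_mod_cast h1
  linarith [Nat.le_ceil v]

lemma summable_blockPow (v : ℝ) : Summable fun n : ℕ => blockPow n v :=
  summable_of_hasFiniteSupport (blockPow_finite_support v)

lemma blockPow_div_le (n : ℕ) (v : ℝ) : blockPow n v / (n + 1) ≤ blockPow n v :=
  div_le_self (blockPow_nonneg n v) (by simp)

lemma summable_blockPow_div (v : ℝ) : Summable fun n : ℕ => blockPow n v / ((n : ℝ) + 1) :=
  Summable.of_nonneg_of_le (fun n => div_nonneg (blockPow_nonneg n v) (by positivity))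
    (fun n => blockPow_div_le n v) (summable_blockPow v)

lemma logKernel_nonneg (v : ℝ) : 0 ≤ logKernel v :=
  tsum_nonneg fun n => div_nonneg (blockPow_nonneg n v) (by positivity)

lemma logKernel_le_one (v : ℝ) : logKernel v ≤ 1 :=
  (summable_blockPow_div v).tsum_le_of_sum_range_le fun N =>
    (Finset.sum_le_sum fun n _ => blockPow_div_le n v).trans (sum_blockPow_le_one N v)

lemma logKernel_eq_zero {v : ℝ} (hv : v ≤ 1) : logKernel v = 0 := by
  have h : ∀ n : ℕ, blockPow n v / ((n : ℝ) + 1) = 0 := fun n => by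
    rw [blockPow_eq_zero, zero_div]
    have : (0 : ℝ) ≤ n := n.cast_nonneg
    linarith
  simp [logKernel, h]

lemma measurable_logKernel : Measurable logKernel := by
  refine measurable_of_tendsto_metrizable
    (f := fun N v => ∑ n ∈ Finset.range N, blockPow n v / ((n : ℝ) + 1)) (fun N => ?_) ?_
  · exact Finset.measurable_fun_sum _ fun n _ =>
      (stronglyMeasurable_blockPow n).measurable.div_const _
  · rw [tendsto_pi_nhds]
    exact fun v => (summable_blockPow_div v).hasSum.tendsto_sum_nat

/-- In the half-plane `Re z > 0`, the Laplace transform of the kernel is a logarithm of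
`1 / (1 - ∫_1^2 e^{-zv} dv)`. -/
lemma exp_neg_integral_logKernel {z : ℂ} (hz : 0 < z.re) :
    Complex.exp (-∫ v : ℝ, Complex.exp (-z * v) * (logKernel v : ℂ)) = 1 - blockTransform z := by
  have hlt : ‖blockTransform z‖ < 1 :=
    (norm_blockTransform_le_of_re_nonneg hz.le).trans_lt (by simpa using hz)
  set F : ℕ → ℝ → ℂ := fun n v => Complex.exp (-z * v) * (blockPow n v : ℂ) / (n + 1) with hF
  have hint : ∀ n, Integrable (F n) := fun n =>
    (integrable_cexp_mul_blockPow z n).1.div_const _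
  have hnorm : ∀ n, ∫ v, ‖F n v‖ ≤ Real.exp (-z.re) ^ n := by
    intro n
    have h1 : ∀ v : ℝ, ‖F n v‖ ≤ Real.exp (-z.re * v) * blockPow n v := by
      intro v
      simp only [hF]
      rw [norm_div, norm_mul, norm_cexp_neg_mul_ofReal, Complex.norm_real, Real.norm_eq_abs,
        abs_of_nonneg (blockPow_nonneg n v)]
      refine div_le_self (mul_nonneg (Real.exp_nonneg _) (blockPow_nonneg n v)) ?_
      have : ((n : ℂ) + 1) = ((n + 1 : ℕ) : ℂ) := by push_cast; rfl
      rw [this, Complex.norm_natCast]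
      simp
    obtain ⟨h2, h3⟩ := integrable_cexp_mul_blockPow (z.re : ℂ) n
    have h4 : (fun v : ℝ => Complex.exp (-(z.re : ℂ) * v) * (blockPow n v : ℂ)) =
        fun v : ℝ => ((Real.exp (-z.re * v) * blockPow n v : ℝ) : ℂ) := by
      funext v; push_cast; rfl
    rw [h4] at h2 h3
    have h5 : Integrable fun v : ℝ => Real.exp (-z.re * v) * blockPow n v := by
      exact h2.re.congr (Eventually.of_forall fun v => Complex.ofReal_re _)
    have h6 : ‖∫ v : ℝ, Real.exp (-z.re * v) * blockPow n v‖ ≤ Real.exp (-z.re) ^ (n + 1) := by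
      rw [← Complex.norm_real, ← integral_complex_ofReal, h3, norm_pow]
      gcongr
      simpa using norm_blockTransform_le_of_re_nonneg (z := (z.re : ℂ)) (by simpa using hz.le)
    calc ∫ v, ‖F n v‖ ≤ ∫ v : ℝ, Real.exp (-z.re * v) * blockPow n v :=
          integral_mono (hint n).norm h5 h1
      _ ≤ Real.exp (-z.re) ^ (n + 1) := (Real.le_norm_self _).trans h6
      _ ≤ Real.exp (-z.re) ^ n :=
          pow_le_pow_of_le_one (Real.exp_nonneg _) (by simpa using hz.le) (by omega)
  have hsum : Summable fun n => ∫ v, ‖F n v‖ :=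
    Summable.of_nonneg_of_le (fun n => integral_nonneg fun v => norm_nonneg _) hnorm
      (summable_geometric_of_lt_one (Real.exp_nonneg _) (by simpa using hz))
  have h1 := hasSum_integral_of_summable_integral_norm hint hsum
  have h2 : ∀ v : ℝ, ∑' n, F n v = Complex.exp (-z * v) * (logKernel v : ℂ) := by
    intro v
    rw [logKernel, Complex.ofReal_tsum, ← tsum_mul_left]
    refine tsum_congr fun n => ?_
    simp only [hF]
    push_cast
    rw [mul_div_assoc]
  have h3 : ∀ n : ℕ, ∫ v, F n v = blockTransform z ^ (n + 1) / ((n + 1 : ℕ) : ℂ) := by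
    intro n
    simp only [hF]
    rw [integral_div, (integrable_cexp_mul_blockPow z n).2]
    push_cast; rfl
  simp only [h2, h3] at h1
  have h4 := (hasSum_nat_add_iff' 1).2 (Complex.hasSum_taylorSeries_neg_log hlt)
  rw [← h4.unique h1]
  simp only [Finset.range_one, Finset.sum_singleton, pow_zero, Nat.cast_zero, div_zero, sub_zero,
    neg_neg]
  refine Complex.exp_log (sub_ne_zero.2 ?_)
  intro h
  rw [← h] at hlt
  simp at hlt

/-! ### The base density -/

lemma hasSum_pow_div_factorial_succ {v : ℝ} (hv : v ≠ 0) :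
    HasSum (fun n : ℕ => v ^ n / ((n + 1).factorial : ℝ)) ((Real.exp v - 1) / v) := by
  have h := NormedSpace.expSeries_div_hasSum_exp v
  rw [← Real.exp_eq_exp_ℝ] at h
  have h1 := ((hasSum_nat_add_iff' 1).2 h).div_const v
  simp only [Finset.range_one, Finset.sum_singleton, pow_zero, Nat.factorial_zero, Nat.cast_one,
    div_one] at h1
  refine h1.congr_fun ?_
  intro n
  field_simp
  rw [pow_succ]

/-- Euler's integral for the Gamma function at the integers, with a complex parameter. -/
lemma integral_pow_mul_cexp {z : ℂ} (hz : 0 < z.re) (n : ℕ) :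
    IntegrableOn (fun v : ℝ => (v : ℂ) ^ n * Complex.exp (-z * v)) (Ioi 0) ∧
      ∫ v in Ioi (0 : ℝ), (v : ℂ) ^ n * Complex.exp (-z * v) =
        (1 / z) ^ (n + 1) * n.factorial := by
  have hz0 : z ≠ 0 := by rintro rfl; simp at hz
  have hint : ∀ n : ℕ,
      IntegrableOn (fun v : ℝ => (v : ℂ) ^ n * Complex.exp (-z * v)) (Ioi 0) := by
    intro n
    have h := integrableOn_rpow_mul_exp_neg_mul_rpow (p := 1) (s := n) (b := z.re)
      (by have : (0 : ℝ) ≤ n := n.cast_nonneg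
          linarith) one_pos hz
    refine Integrable.mono' h (by fun_prop) ?_
    filter_upwards [ae_restrict_mem measurableSet_Ioi] with v (hv : 0 < v)
    rw [norm_mul, norm_cexp_neg_mul_ofReal, norm_pow, Complex.norm_real, Real.norm_of_nonneg hv.le]
    simp
  refine ⟨hint n, ?_⟩
  have hlim : ∀ n : ℕ,
      Tendsto (fun v : ℝ => (v : ℂ) ^ n * Complex.exp (-z * v)) atTop (𝓝 0) := by
    intro n
    rw [tendsto_zero_iff_norm_tendsto_zero]
    refine (tendsto_rpow_mul_exp_neg_mul_atTop_nhds_zero n z.re hz).congr' ?_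
    filter_upwards [eventually_gt_atTop 0] with v hv
    rw [norm_mul, norm_cexp_neg_mul_ofReal, norm_pow, Complex.norm_real, Real.norm_of_nonneg hv.le,
      Real.rpow_natCast]
  have hexp : ∀ v : ℝ, HasDerivAt (fun v : ℝ => Complex.exp (-z * v))
      (Complex.exp (-z * v) * (-z * 1)) v := fun v =>
    ((Complex.ofRealCLM.hasDerivAt (x := v)).const_mul (-z)).cexp
  induction n with
  | zero =>
    have h := integral_Ioi_of_hasDerivAt_of_tendsto (a := (0 : ℝ))
      (f := fun v : ℝ => Complex.exp (-z * v)) (by fun_prop) (fun v _ => hexp v)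
      (by simpa [IntegrableOn] using (hint 0).mul_const (-z * 1)) (by simpa using hlim 0)
    rw [integral_mul_const] at h
    simp only [pow_zero, one_mul, Nat.factorial_zero, Nat.cast_one, mul_one, zero_add, pow_one]
    simp only [Complex.ofReal_zero, mul_zero, Complex.exp_zero, mul_one] at h
    rw [eq_div_iff hz0]
    linear_combination -h
  | succ n ih =>
    have hd : ∀ v : ℝ, HasDerivAt (fun v : ℝ => (v : ℂ) ^ (n + 1) * Complex.exp (-z * v))
        (((n : ℂ) + 1) * ((v : ℂ) ^ n * Complex.exp (-z * v)) -
          z * ((v : ℂ) ^ (n + 1) * Complex.exp (-z * v))) v := by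
      intro v
      have h1 : HasDerivAt (fun v : ℝ => (v : ℂ) ^ (n + 1))
          (((n + 1 : ℕ) : ℂ) * (v : ℂ) ^ n * 1) v :=
        (Complex.ofRealCLM.hasDerivAt (x := v)).fun_pow (n + 1)
      refine (h1.fun_mul (hexp v)).congr_deriv ?_
      push_cast
      ring
    have h := integral_Ioi_of_hasDerivAt_of_tendsto (a := (0 : ℝ))
      (f := fun v : ℝ => (v : ℂ) ^ (n + 1) * Complex.exp (-z * v)) (by fun_prop)
      (fun v _ => hd v) (((hint n).const_mul _).sub ((hint (n + 1)).const_mul _)) (hlim (n + 1))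
    rw [integral_sub ((hint n).const_mul _) ((hint (n + 1)).const_mul _), integral_const_mul,
      integral_const_mul, ih] at h
    simp only [Complex.ofReal_zero, ne_eq, Nat.add_eq_zero_iff, one_ne_zero, and_false,
      not_false_eq_true, zero_pow, zero_mul, sub_zero] at h
    rw [Nat.factorial_succ, pow_succ]
    push_cast
    have h2 := sub_eq_zero.1 h
    rw [← mul_right_inj' hz0, ← h2]
    field_simp

/-- The density `(e^v - 1) / v` has Laplace transform `log (s / (s - 1))`, and so it contributes
the simple pole at `s = 1` to the zeta function. -/
lemma integral_base_density {s : ℂ} (hs : 1 < s.re) :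
    IntegrableOn (fun v : ℝ => Complex.exp (-s * v) * (((Real.exp v - 1) / v : ℝ) : ℂ)) (Ioi 0) ∧
      Complex.exp (∫ v in Ioi (0 : ℝ), Complex.exp (-s * v) * (((Real.exp v - 1) / v : ℝ) : ℂ)) =
        s / (s - 1) := by
  have hs0 : s ≠ 0 := by rintro rfl; simp at hs; linarith
  have hs1 : 1 < ‖s‖ := hs.trans_le (Complex.re_le_norm s)
  set F : ℕ → ℝ → ℂ := fun n v =>
    Complex.exp (-s * v) * ((v ^ n / ((n + 1).factorial : ℝ) : ℝ) : ℂ) with hF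
  have hG : ∀ (z : ℂ), 1 < z.re → ∀ n : ℕ,
      ∫ v in Ioi (0 : ℝ), Complex.exp (-z * v) * ((v ^ n / ((n + 1).factorial : ℝ) : ℝ) : ℂ) =
        (1 / z) ^ (n + 1) / ((n + 1 : ℕ) : ℂ) := by
    intro z hz n
    have h3 : ∀ v : ℝ, Complex.exp (-z * v) * ((v ^ n / ((n + 1).factorial : ℝ) : ℝ) : ℂ) =
        (v : ℂ) ^ n * Complex.exp (-z * v) / ((n + 1).factorial : ℂ) := by
      intro v; push_cast; ring
    simp_rw [h3]
    rw [integral_div, (integral_pow_mul_cexp (by linarith) n).2, Nat.factorial_succ]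
    have : (n.factorial : ℂ) ≠ 0 := by exact_mod_cast n.factorial_ne_zero
    have h5 : ((n + 1 : ℕ) : ℂ) ≠ 0 := by exact_mod_cast n.succ_ne_zero
    push_cast at h5 ⊢
    field_simp
  have hint : ∀ n, IntegrableOn (F n) (Ioi 0) := by
    intro n
    -- a nonzero Bochner integral implies integrability
    refine Integrable.of_integral_ne_zero ?_
    rw [hG s hs n]
    have h5 : ((n + 1 : ℕ) : ℂ) ≠ 0 := by exact_mod_cast n.succ_ne_zero
    exact div_ne_zero (pow_ne_zero _ (one_div_ne_zero hs0)) h5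
  have hnorm : ∀ n, ∫ v in Ioi (0 : ℝ), ‖F n v‖ ≤ (1 / s.re) ^ n := by
    intro n
    have h1 : ∫ v in Ioi (0 : ℝ), ‖F n v‖ =
        ∫ v in Ioi (0 : ℝ), Real.exp (-s.re * v) * (v ^ n / ((n + 1).factorial : ℝ)) := by
      refine setIntegral_congr_fun measurableSet_Ioi fun v (hv : 0 < v) => ?_
      simp only [hF]
      rw [norm_mul, norm_cexp_neg_mul_ofReal, Complex.norm_real, Real.norm_of_nonneg]
      positivity
    have h2 := hG (s.re : ℂ) (by simpa using hs) n
    have h3 : ((∫ v in Ioi (0 : ℝ), Real.exp (-s.re * v) * (v ^ n / ((n + 1).factorial : ℝ)) : ℝ)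
        : ℂ) = ((1 / s.re) ^ (n + 1) / ((n + 1 : ℕ) : ℝ) : ℝ) := by
      rw [← integral_complex_ofReal]
      refine Eq.trans ?_ (h2.trans ?_)
      · congr 1; funext v; push_cast; rfl
      · push_cast; rfl
    rw [h1, Complex.ofReal_inj.1 h3]
    have h4 : (0 : ℝ) ≤ 1 / s.re := by positivity
    have h5 : 1 / s.re ≤ 1 := by rw [div_le_one (by linarith)]; exact hs.le
    refine (div_le_self (by positivity) ?_).trans (pow_le_pow_of_le_one h4 h5 (by omega))
    exact_mod_cast Nat.le_add_left 1 n
  have hlt1 : 1 / s.re < 1 := by rw [div_lt_one (by linarith)]; exact hs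
  have hsum : Summable fun n => ∫ v in Ioi (0 : ℝ), ‖F n v‖ :=
    Summable.of_nonneg_of_le (fun n => integral_nonneg fun v => norm_nonneg _) hnorm
      (summable_geometric_of_lt_one (by positivity) hlt1)
  have h1 := hasSum_integral_of_summable_integral_norm hint hsum
  have h2 : ∀ v ∈ Ioi (0 : ℝ), ∑' n, F n v =
      Complex.exp (-s * v) * (((Real.exp v - 1) / v : ℝ) : ℂ) := by
    intro v hv
    simp only [hF]
    rw [tsum_mul_left, ← Complex.ofReal_tsum,
      (hasSum_pow_div_factorial_succ (ne_of_gt hv)).tsum_eq]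
  rw [setIntegral_congr_fun measurableSet_Ioi h2] at h1
  have hlt : ‖1 / s‖ < 1 := by
    rw [norm_div, norm_one, div_lt_one (by linarith)]; exact hs1
  have h4 := (hasSum_nat_add_iff' 1).2 (Complex.hasSum_taylorSeries_neg_log hlt)
  simp only [hF, hG s hs] at h1
  have h5 := h1.unique h4
  have hs2 : s - 1 ≠ 0 := by
    intro h
    rw [sub_eq_zero.1 h] at hs1; simp at hs1
  have hexp : Complex.exp (∫ v in Ioi (0 : ℝ),
      Complex.exp (-s * v) * (((Real.exp v - 1) / v : ℝ) : ℂ)) = s / (s - 1) := by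
    rw [h5]
    simp only [Finset.range_one, Finset.sum_singleton, pow_zero, Nat.cast_zero, div_zero, sub_zero]
    have hne : 1 - 1 / s ≠ 0 := by
      intro h
      rw [← sub_eq_zero.1 h] at hlt
      simp at hlt
    rw [Complex.exp_neg, Complex.exp_log hne]
    field_simp
  -- the integral is nonzero, since its exponential `s / (s - 1)` is not `1`; as the Bochner
  -- integral of a non-integrable function is `0`, this gives the integrability
  refine ⟨Integrable.of_integral_ne_zero fun h => ?_, hexp⟩
  rw [h, Complex.exp_zero, eq_div_iff hs2, one_mul] at hexp
  simp at hexp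

/-! ### The product over the zeros -/

/-- Growth conditions on the heights `t n` of the prescribed zeros `1 - 1 / l n + i t n` and on the
reciprocals `l n` of their distances to the line `σ = 1`: both sequences are sparse, and `l n` is
small compared with `log (t n)`. -/
structure IsSparse (l t : ℕ → ℝ) : Prop where
  ten_le : 10 ≤ l 0
  mul_le_succ : ∀ n : ℕ, 100 * ((n : ℝ) + 2) * l n ≤ l (n + 1)
  pow_le : ∀ n : ℕ, 16 ^ n ≤ t n
  four_mul_le : ∀ n : ℕ, 4 * t n ≤ t (n + 1)
  le_log : ∀ n : ℕ, 8 * l n ≤ Real.log (t n)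

/-- The affine change of variable under which the zero `1 - 1 / l + i τ` corresponds to `0`. -/
noncomputable def zeroCoord (l τ : ℝ) (s : ℂ) : ℂ := l * (s - 1 - τ * Complex.I) + 1

/-- The infinite product `∏ G (l n (s - ρ n))`, where `ρ n = 1 - 1 / l n + i τ n` and
`G z = 1 - ∫_1^2 e^{-zv} dv`. -/
noncomputable def zeroProduct (l τ : ℕ → ℝ) (s : ℂ) : ℂ :=
  ∏' n, (1 + -blockTransform (zeroCoord (l n) (τ n) s))

lemma zeroCoord_re (l τ : ℝ) (s : ℂ) : (zeroCoord l τ s).re = l * (s.re - 1) + 1 := by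
  simp [zeroCoord]

lemma zeroCoord_im (l τ : ℝ) (s : ℂ) : (zeroCoord l τ s).im = l * (s.im - τ) := by
  simp [zeroCoord]

lemma differentiable_zeroCoord (l τ : ℝ) : Differentiable ℂ (zeroCoord l τ) := by
  unfold zeroCoord; fun_prop

namespace IsSparse

variable {l t τ : ℕ → ℝ} (H : IsSparse l t)

include H

lemma ten_le_l (n : ℕ) : 10 ≤ l n := by
  induction n with
  | zero => exact H.ten_le
  | succ n ih =>
    have h := H.mul_le_succ n
    have hn : (0 : ℝ) ≤ n := n.cast_nonneg
    nlinarith [mul_nonneg hn (by linarith : (0 : ℝ) ≤ l n)]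

lemma t_pos (n : ℕ) : 0 < t n := lt_of_lt_of_le (by positivity) (H.pow_le n)

lemma exp_mul_pow_le (n : ℕ) : Real.exp (4 * l n) * 4 ^ n ≤ t n := by
  have h1 : Real.exp (8 * l n) ≤ t n := (Real.le_log_iff_exp_le (H.t_pos n)).1 (H.le_log n)
  have h2 := H.pow_le n
  refine (sq_le_sq₀ (by positivity) (H.t_pos n).le).1 ?_
  calc (Real.exp (4 * l n) * 4 ^ n) ^ 2 = Real.exp (8 * l n) * 16 ^ n := by
        rw [mul_pow, ← pow_mul, mul_comm n 2, pow_mul, ← Real.exp_nat_mul]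
        norm_num
        ring_nf
    _ ≤ t n * t n := by gcongr; exact (H.t_pos n).le
    _ = t n ^ 2 := by ring

/-- Away from the height of its zero, a factor of the product is close to `1`. -/
lemma norm_blockTransform_far {s : ℂ} (hs : -1 ≤ s.re) {n : ℕ}
    (hfar : t n / 2 ≤ |s.im - τ n|) :
    ‖blockTransform (zeroCoord (l n) (τ n) s)‖ ≤ 4 * (1 / 4) ^ n := by
  have hl := H.ten_le_l n
  have ht := H.t_pos n
  have him : t n / 2 ≤ ‖zeroCoord (l n) (τ n) s‖ := by
    refine le_trans ?_ (Complex.abs_im_le_norm _)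
    rw [zeroCoord_im, abs_mul, abs_of_pos (by linarith)]
    nlinarith
  have h0 : zeroCoord (l n) (τ n) s ≠ 0 := by
    intro h
    rw [h, norm_zero] at him
    linarith
  have h := norm_blockTransform_le_div (a := 2 * l n) (z := zeroCoord (l n) (τ n) s) (by linarith)
    (by rw [zeroCoord_re]; nlinarith) h0
  have hexp := H.exp_mul_pow_le n
  calc ‖blockTransform (zeroCoord (l n) (τ n) s)‖
      ≤ 2 * Real.exp (2 * (2 * l n)) / ‖zeroCoord (l n) (τ n) s‖ := h
    _ ≤ 2 * Real.exp (4 * l n) / (t n / 2) := by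
        rw [show 2 * (2 * l n) = 4 * l n by ring]
        gcongr
    _ ≤ 4 * (1 / 4) ^ n := by
        rw [div_le_iff₀ (by positivity), one_div, inv_pow]
        have h4 : (0 : ℝ) < 4 ^ n := by positivity
        have : Real.exp (4 * l n) ≤ (4 ^ n)⁻¹ * t n := by
          rw [← div_eq_inv_mul, le_div_iff₀ h4]; exact hexp
        linarith

lemma norm_blockTransform_le_geometric (hτ : ∀ n, |τ n| = t n) {s : ℂ} (hs : -1 ≤ s.re) {R : ℝ}
    (hR : ‖s‖ ≤ R) (n : ℕ) :
    ‖blockTransform (zeroCoord (l n) (τ n) s)‖ ≤ (4 + 2 * R) * (1 / 4) ^ n := by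
  have hl := H.ten_le_l n
  have hR0 : 0 ≤ R := (norm_nonneg s).trans hR
  have h4 : (0 : ℝ) < (1 / 4) ^ n := by positivity
  rcases le_or_gt (2 * R) (t n) with h | h
  · refine (H.norm_blockTransform_far hs ?_).trans ?_
    · have h1 := Complex.abs_im_le_norm s
      have h2 := abs_sub_abs_le_abs_sub (τ n) s.im
      rw [abs_sub_comm, hτ] at h2
      linarith
    · nlinarith
  · have h1 := norm_blockTransform_le (a := 2 * l n) (z := zeroCoord (l n) (τ n) s) (by linarith)
      (by rw [zeroCoord_re]; nlinarith)
    rw [show 2 * (2 * l n) = 4 * l n by ring] at h1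
    have h2 := H.exp_mul_pow_le n
    have h3 : Real.exp (4 * l n) ≤ t n * (1 / 4) ^ n := by
      rw [one_div, inv_pow, ← div_eq_mul_inv, le_div_iff₀ (by positivity)]; exact h2
    nlinarith

lemma summable_norm_blockTransform (hτ : ∀ n, |τ n| = t n) {s : ℂ} (hs : -1 ≤ s.re) :
    Summable fun n => ‖-blockTransform (zeroCoord (l n) (τ n) s)‖ := by
  refine Summable.of_nonneg_of_le (fun n => norm_nonneg _) (fun n => ?_)
    ((summable_geometric_of_lt_one (r := (1 / 4 : ℝ)) (by norm_num) (by norm_num)).mul_left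
      (4 + 2 * ‖s‖))
  rw [norm_neg]
  exact H.norm_blockTransform_le_geometric hτ hs le_rfl n

lemma multipliable_zeroProduct (hτ : ∀ n, |τ n| = t n) {s : ℂ} (hs : -1 ≤ s.re) :
    Multipliable fun n => 1 + -blockTransform (zeroCoord (l n) (τ n) s) :=
  multipliable_one_add_of_summable (H.summable_norm_blockTransform hτ hs)

lemma differentiableOn_zeroProduct (hτ : ∀ n, |τ n| = t n) :
    DifferentiableOn ℂ (zeroProduct l τ) {s | -1 < s.re} := by
  intro s₀ hs₀
  set U : Set ℂ := {s | -1 < s.re} ∩ Metric.ball 0 (‖s₀‖ + 1) with hU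
  have hUo : IsOpen U := (isOpen_lt continuous_const Complex.continuous_re).inter Metric.isOpen_ball
  have hd : ∀ n, Differentiable ℂ fun s => -blockTransform (zeroCoord (l n) (τ n) s) := fun n =>
    (differentiable_blockTransform.comp (differentiable_zeroCoord _ _)).neg
  have h := Summable.hasProdLocallyUniformlyOn_nat_one_add hUo
    (f := fun n s => -blockTransform (zeroCoord (l n) (τ n) s))
    ((summable_geometric_of_lt_one (r := (1 / 4 : ℝ)) (by norm_num) (by norm_num)).mul_left
      (4 + 2 * (‖s₀‖ + 1)))
    (Eventually.of_forall fun n s hs => by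
      rw [norm_neg]
      exact H.norm_blockTransform_le_geometric hτ hs.1.le
        (by simpa using (mem_ball_zero_iff.1 hs.2).le) n)
    (fun n => (hd n).continuous.continuousOn)
  have h2 : DifferentiableOn ℂ (zeroProduct l τ) U :=
    h.differentiableOn (Eventually.of_forall fun S => by
      have : Differentiable ℂ
          fun s => ∏ n ∈ S, (1 + -blockTransform (zeroCoord (l n) (τ n) s)) :=
        Differentiable.fun_finsetProd fun n _ => (hd n).const_add 1
      exact this.differentiableOn) hUo
  exact (h2.differentiableAt (hUo.mem_nhds ⟨hs₀, by simp⟩)).differentiableWithinAt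

lemma zeroProduct_ne_zero (hτ : ∀ n, |τ n| = t n) {s : ℂ} (hs : 1 ≤ s.re) :
    zeroProduct l τ s ≠ 0 := by
  refine tprod_one_add_ne_zero_of_summable (fun n h => ?_)
    (H.summable_norm_blockTransform hτ (by linarith))
  have hl := H.ten_le_l n
  have hre : 1 ≤ (zeroCoord (l n) (τ n) s).re := by rw [zeroCoord_re]; nlinarith
  have h1 := norm_blockTransform_le_of_re_nonneg (zero_le_one.trans hre)
  have h2 : blockTransform (zeroCoord (l n) (τ n) s) = 1 := by linear_combination -h
  rw [h2, norm_one, Real.one_le_exp_iff] at h1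
  linarith

/-- If at most one factor of the product, the one with index `k`, is not known to be close to `1`,
then the size of the product is controlled by that factor. The constant `16 / 3` in the exponent is
`∑ 4 * 4^{-n}`. -/
lemma norm_zeroProduct_le (hτ : ∀ n, |τ n| = t n) {s : ℂ} (hs : 0 ≤ s.re) {A : ℝ} {k : ℕ}
    (hA : 1 + ‖blockTransform (zeroCoord (l k) (τ k) s)‖ ≤ A)
    (hfar : ∀ n, n ≠ k → t n / 2 ≤ |s.im - τ n|) :
    ‖zeroProduct l τ s‖ ≤ A * Real.exp (16 / 3) := by
  have hA1 : 1 ≤ A := by linarith [norm_nonneg (blockTransform (zeroCoord (l k) (τ k) s))]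
  have hgeo : HasSum (fun n : ℕ => 4 * (1 / 4 : ℝ) ^ n) (16 / 3) := by
    have := (hasSum_geometric_of_lt_one (r := (1 / 4 : ℝ)) (by norm_num) (by norm_num)).mul_left 4
    norm_num at this ⊢
    exact this
  have hfac : ∀ n, ‖1 + -blockTransform (zeroCoord (l n) (τ n) s)‖ ≤
      (if n = k then A else 1) * Real.exp (4 * (1 / 4 : ℝ) ^ n) := by
    intro n
    have h1 : ‖1 + -blockTransform (zeroCoord (l n) (τ n) s)‖ ≤
        1 + ‖blockTransform (zeroCoord (l n) (τ n) s)‖ := by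
      simpa using norm_add_le (1 : ℂ) (-blockTransform (zeroCoord (l n) (τ n) s))
    have h4 : (0 : ℝ) ≤ 4 * (1 / 4) ^ n := by positivity
    split_ifs with hn
    · subst hn
      have := Real.one_le_exp h4
      nlinarith
    · have h2 := H.norm_blockTransform_far (τ := τ) (by linarith : -1 ≤ s.re) (hfar n hn)
      have h3 := Real.add_one_le_exp (4 * (1 / 4 : ℝ) ^ n)
      linarith
  refine le_of_tendsto (H.multipliable_zeroProduct hτ (by linarith)).hasProd.norm
    (Eventually.of_forall fun S => ?_)
  calc ∏ n ∈ S, ‖1 + -blockTransform (zeroCoord (l n) (τ n) s)‖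
      ≤ ∏ n ∈ S, ((if n = k then A else 1) * Real.exp (4 * (1 / 4 : ℝ) ^ n)) :=
        Finset.prod_le_prod (fun _ _ => norm_nonneg _) fun n _ => hfac n
    _ = (∏ n ∈ S, if n = k then A else 1) * Real.exp (∑ n ∈ S, 4 * (1 / 4 : ℝ) ^ n) := by
        rw [Finset.prod_mul_distrib, Real.exp_sum]
    _ ≤ A * Real.exp (16 / 3) := by
        gcongr
        · rw [Finset.prod_ite_eq']
          split_ifs <;> simp [hA1]
        · exact sum_le_hasSum S (fun n _ => by positivity) hgeo

lemma four_mul_t_le_of_lt {m n : ℕ} (hmn : m < n) : 4 * t m ≤ t n := by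
  induction n, hmn using Nat.le_induction with
  | base => exact H.four_mul_le m
  | succ n _ ih => linarith [H.four_mul_le n, H.t_pos n]

/-- At every height, at most one of the zeros is near. -/
lemma exists_far (y : ℝ) : ∃ k, ∀ n, n ≠ k → t n / 2 ≤ |y - t n| := by
  by_cases h : ∃ k, |y - t k| < t k / 2
  · obtain ⟨k, hk⟩ := h
    refine ⟨k, fun n hn => ?_⟩
    by_contra! hcon
    rw [abs_lt] at hk hcon
    rcases lt_or_gt_of_ne hn with h | h
    · linarith [H.four_mul_t_le_of_lt h, H.t_pos k, H.t_pos n]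
    · linarith [H.four_mul_t_le_of_lt h, H.t_pos k, H.t_pos n]
  · push Not at h
    exact ⟨0, fun n _ => h n⟩

lemma zeroProduct_eq_zero (k : ℕ) : zeroProduct l τ (1 - (1 / l k : ℝ) + τ k * Complex.I) = 0 := by
  have hl : (l k : ℂ) ≠ 0 := by
    have := H.ten_le_l k
    exact_mod_cast (by linarith : l k ≠ 0)
  refine tprod_of_exists_eq_zero ⟨k, ?_⟩
  have : zeroCoord (l k) (τ k) (1 - (1 / l k : ℝ) + τ k * Complex.I) = 0 := by
    rw [zeroCoord]; push_cast; field_simp; ring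
  rw [this, blockTransform_zero]
  ring

end IsSparse

/-! ### The prime density -/

/-- The amplitude, in the variable `v = log x`, of the oscillation of the prime density that is
caused by a zero at distance `1 / l` from the line `σ = 1`. -/
noncomputable def zeroAmplitude (l v : ℝ) : ℝ := Real.exp (v - v / l) * logKernel (v / l) / l

/-- The density of `dΠ` in the variable `v = log x`. -/
noncomputable def primeDensity (l t : ℕ → ℝ) (v : ℝ) : ℝ :=
  (Real.exp v - 1) / v - ∑' n, 2 * Real.cos (t n * v) * zeroAmplitude (l n) v

/-- The measure on `(1, ∞)` with the density `primeDensity` in the variable `log x`. -/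
noncomputable def primeMeasure (l t : ℕ → ℝ) : Measure ℝ :=
  ((volume.restrict (Ioi 0)).withDensity
    fun v => ENNReal.ofReal (primeDensity l t v)).map Real.exp

lemma measurable_zeroAmplitude (l : ℝ) : Measurable (zeroAmplitude l) := by
  have h : Measurable fun v : ℝ => logKernel (v / l) :=
    measurable_logKernel.comp (measurable_id.div_const l)
  unfold zeroAmplitude
  fun_prop

lemma mul_exp_neg_le_exp_neg_one (y : ℝ) : y * Real.exp (-y) ≤ Real.exp (-1) := by
  have h := Real.add_one_le_exp (y - 1)
  calc y * Real.exp (-y) ≤ Real.exp (y - 1) * Real.exp (-y) := by gcongr; linarith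
    _ = Real.exp (-1) := by rw [← Real.exp_add]; ring_nf

lemma mul_exp_neg_le_two_div {y : ℝ} (hy : 0 < y) : y * Real.exp (-y) ≤ 2 / y := by
  have h := Real.quadratic_le_exp_of_nonneg hy.le
  rw [Real.exp_neg, ← div_eq_mul_inv, div_le_div_iff₀ (Real.exp_pos _) hy]
  nlinarith

lemma zeroAmplitude_nonneg {l : ℝ} (hl : 0 < l) (v : ℝ) : 0 ≤ zeroAmplitude l v :=
  div_nonneg (mul_nonneg (Real.exp_nonneg _) (logKernel_nonneg _)) hl.le

lemma zeroAmplitude_eq_zero {l v : ℝ} (hl : 0 < l) (hv : v ≤ l) : zeroAmplitude l v = 0 := by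
  rw [zeroAmplitude, logKernel_eq_zero ((div_le_one hl).2 hv)]; simp

lemma mul_zeroAmplitude_le {l v : ℝ} (hl : 0 < l) (hv : 0 < v) :
    v * zeroAmplitude l v ≤ Real.exp v * (v / l * Real.exp (-(v / l))) := by
  have h := logKernel_le_one (v / l)
  rw [zeroAmplitude, sub_eq_add_neg, Real.exp_add]
  calc v * (Real.exp v * Real.exp (-(v / l)) * logKernel (v / l) / l)
      = Real.exp v * (v / l * Real.exp (-(v / l))) * logKernel (v / l) := by ring
    _ ≤ _ := mul_le_of_le_one_right (by positivity) h

lemma integral_zeroAmplitude {l τ : ℝ} (hl : 0 < l) (s : ℂ) :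
    ∫ v in Ioi (0 : ℝ), Complex.exp (-s * v) *
        (Complex.exp (τ * Complex.I * v) * (zeroAmplitude l v : ℂ)) =
      ∫ u : ℝ, Complex.exp (-zeroCoord l τ s * u) * (logKernel u : ℂ) := by
  have hl' : (l : ℂ) ≠ 0 := by exact_mod_cast hl.ne'
  rw [setIntegral_eq_integral_of_forall_compl_eq_zero]
  · have h := Measure.integral_comp_div
      (fun u : ℝ => Complex.exp (-zeroCoord l τ s * u) * (logKernel u : ℂ)) l
    rw [abs_of_pos hl, Complex.real_smul] at h
    rw [← mul_right_inj' hl', ← h, ← integral_const_mul]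
    congr 1
    funext v
    rw [zeroAmplitude]
    push_cast
    rw [← mul_assoc (Complex.exp _) (Complex.exp _), ← Complex.exp_add, mul_div_assoc',
      ← mul_assoc (Complex.exp _) (Complex.exp _), ← Complex.exp_add, mul_div_cancel₀ _ hl']
    congr 2
    rw [zeroCoord]
    field_simp
    ring
  · intro v hv
    rw [zeroAmplitude_eq_zero hl (le_trans (by simpa using hv) hl.le)]
    simp

lemma primeMeasure_Iic_one (l t : ℕ → ℝ) : primeMeasure l t (Iic 1) = 0 := by
  rw [primeMeasure, Measure.map_apply Real.measurable_exp measurableSet_Iic]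
  refine withDensity_absolutelyContinuous _ _ ?_
  rw [Measure.restrict_apply (Real.measurable_exp measurableSet_Iic)]
  convert measure_empty (μ := (volume : Measure ℝ))
  ext v
  simp only [mem_inter_iff, mem_preimage, mem_Iic, mem_Ioi, mem_empty_iff_false, iff_false,
    not_and, not_lt]
  intro h
  simpa using h

namespace IsSparse

variable {l t : ℕ → ℝ} (H : IsSparse l t)

include H

lemma l_pos (n : ℕ) : 0 < l n := by linarith [H.ten_le_l n]

lemma mul_l_le_of_lt {m n : ℕ} (hmn : m < n) : 100 * ((n : ℝ) + 1) * l m ≤ l n := by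
  induction n, hmn using Nat.le_induction with
  | base => have := H.mul_le_succ m; push_cast; linarith
  | succ n hmn ih =>
    have h := H.mul_le_succ n
    have hn : (0 : ℝ) ≤ n := n.cast_nonneg
    have hlm := H.l_pos m
    have h1 : l m ≤ l n := by nlinarith [mul_nonneg hn hlm.le]
    push_cast
    nlinarith [mul_le_mul_of_nonneg_left h1 (by positivity : (0 : ℝ) ≤ 100 * ((n : ℝ) + 2))]

/-- The oscillations caused by the zeros are together dominated by the main term of the prime
density: the last zero that contributes at `v` has at most the share `2 / e`, and the preceding
ones are negligible, because of the sparsity. -/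
lemma sum_mul_zeroAmplitude_le (N : ℕ) {v : ℝ} (hv : 0 < v) :
    ∑ n ∈ Finset.range N, 2 * (v * zeroAmplitude (l n) v) ≤ 4 / 5 * Real.exp v := by
  have hev := Real.exp_pos v
  induction N with
  | zero => simp; positivity
  | succ N ih =>
    rw [Finset.sum_range_succ]
    rcases le_or_gt v (l N) with h | h
    · rw [zeroAmplitude_eq_zero (H.l_pos N) h]; simpa using ih
    have he : Real.exp (-1) ≤ 0.37 := by
      rw [Real.exp_neg, inv_le_comm₀ (Real.exp_pos _) (by norm_num)]
      have := Real.exp_one_gt_d9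
      norm_num at this ⊢
      linarith
    have hN : (0 : ℝ) ≤ N := N.cast_nonneg
    have hlast := mul_zeroAmplitude_le (H.l_pos N) hv
    have hlast2 := mul_exp_neg_le_exp_neg_one (v / l N)
    have hprev : ∀ n ∈ Finset.range N, 2 * (v * zeroAmplitude (l n) v) ≤
        Real.exp v * (4 / (100 * ((N : ℝ) + 1))) := by
      intro n hn
      have hn' := H.mul_l_le_of_lt (Finset.mem_range.1 hn)
      have hln := H.l_pos n
      have hy : 100 * ((N : ℝ) + 1) ≤ v / l n := by rw [le_div_iff₀ hln]; linarith
      have hy0 : 0 < v / l n := by positivity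
      have h1 := mul_zeroAmplitude_le hln hv
      have h2 := mul_exp_neg_le_two_div hy0
      have h3 : 2 / (v / l n) ≤ 2 / (100 * ((N : ℝ) + 1)) := by gcongr
      have h4 := mul_le_mul_of_nonneg_left (h2.trans h3) hev.le
      calc 2 * (v * zeroAmplitude (l n) v)
          ≤ 2 * (Real.exp v * (2 / (100 * ((N : ℝ) + 1)))) := by linarith
        _ = _ := by ring
    have hsum := Finset.sum_le_sum hprev
    rw [Finset.sum_const, Finset.card_range, nsmul_eq_mul] at hsum
    have h5 : (N : ℝ) * (Real.exp v * (4 / (100 * ((N : ℝ) + 1)))) ≤ 0.04 * Real.exp v := by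
      rw [mul_left_comm, mul_comm]
      gcongr
      rw [mul_div_assoc', div_le_iff₀ (by positivity)]
      linarith
    have h6 := mul_le_mul_of_nonneg_left (hlast2.trans he) hev.le
    linarith

lemma zeroAmplitude_eq_zero_of_le (n : ℕ) {v : ℝ} (hv : v ≤ 10) : zeroAmplitude (l n) v = 0 :=
  _root_.zeroAmplitude_eq_zero (H.l_pos n) (hv.trans (H.ten_le_l n))

lemma sum_zeroAmplitude_le (N : ℕ) {v : ℝ} (hv : 0 < v) :
    ∑ n ∈ Finset.range N, 2 * zeroAmplitude (l n) v ≤ 4 / 5 * Real.exp v / v := by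
  rw [le_div_iff₀ hv, Finset.sum_mul]
  refine (Finset.sum_le_sum fun n _ => ?_).trans (H.sum_mul_zeroAmplitude_le N hv)
  exact le_of_eq (by ring)

lemma summable_zeroAmplitude (v : ℝ) : Summable fun n => zeroAmplitude (l n) v := by
  rcases le_or_gt v 10 with h | h
  · simp [H.zeroAmplitude_eq_zero_of_le _ h]
  · have h2 : Summable fun n => 2 * zeroAmplitude (l n) v :=
      summable_of_sum_range_le
        (fun n => mul_nonneg zero_le_two (zeroAmplitude_nonneg (H.l_pos n) v))
        fun N => H.sum_zeroAmplitude_le N (by linarith)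
    exact (summable_mul_left_iff two_ne_zero).1 h2

lemma tsum_zeroAmplitude_le {v : ℝ} (hv : 0 < v) :
    ∑' n, 2 * zeroAmplitude (l n) v ≤ 4 / 5 * Real.exp v / v :=
  ((H.summable_zeroAmplitude v).mul_left 2).tsum_le_of_sum_range_le fun N =>
    H.sum_zeroAmplitude_le N hv

lemma tsum_zeroAmplitude_le_exp (v : ℝ) : ∑' n, zeroAmplitude (l n) v ≤ Real.exp v := by
  rcases le_or_gt v 10 with h | h
  · simp [H.zeroAmplitude_eq_zero_of_le _ h]; positivity
  · have h1 := H.tsum_zeroAmplitude_le (by linarith : 0 < v)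
    rw [tsum_mul_left] at h1
    have h2 : 4 / 5 * Real.exp v / v ≤ Real.exp v := by
      rw [div_le_iff₀ (by linarith)]
      nlinarith [Real.exp_pos v]
    have h3 : 0 ≤ ∑' n, zeroAmplitude (l n) v :=
      tsum_nonneg fun n => zeroAmplitude_nonneg (H.l_pos n) v
    linarith

lemma abs_cos_mul_zeroAmplitude_le (n : ℕ) (v : ℝ) :
    ‖2 * Real.cos (t n * v) * zeroAmplitude (l n) v‖ ≤ 2 * zeroAmplitude (l n) v := by
  have h := zeroAmplitude_nonneg (H.l_pos n) v
  rw [norm_mul, norm_mul, Real.norm_eq_abs (Real.cos _), Real.norm_of_nonneg h,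
    Real.norm_of_nonneg zero_le_two]
  have := Real.abs_cos_le_one (t n * v)
  nlinarith

lemma summable_cos_mul_zeroAmplitude (v : ℝ) :
    Summable fun n => 2 * Real.cos (t n * v) * zeroAmplitude (l n) v :=
  Summable.of_norm_bounded ((H.summable_zeroAmplitude v).mul_left 2)
    fun n => H.abs_cos_mul_zeroAmplitude_le n v

lemma primeDensity_nonneg {v : ℝ} (hv : 0 < v) : 0 ≤ primeDensity l t v := by
  have he := Real.add_one_le_exp v
  rw [primeDensity, sub_nonneg]
  rcases le_or_gt v 10 with h | h
  · simp only [H.zeroAmplitude_eq_zero_of_le _ h, mul_zero, tsum_zero]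
    exact div_nonneg (by linarith) hv.le
  · have h1 : ∑' n, 2 * Real.cos (t n * v) * zeroAmplitude (l n) v ≤
        ∑' n, 2 * zeroAmplitude (l n) v :=
      (H.summable_cos_mul_zeroAmplitude v).tsum_le_tsum
        (fun n => (Real.le_norm_self _).trans (H.abs_cos_mul_zeroAmplitude_le n v))
        ((H.summable_zeroAmplitude v).mul_left 2)
    refine (h1.trans (H.tsum_zeroAmplitude_le hv)).trans ?_
    gcongr
    linarith

lemma measurable_primeDensity : Measurable (primeDensity l t) := by
  have h : Measurable fun v => ∑' n, 2 * Real.cos (t n * v) * zeroAmplitude (l n) v := by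
    refine measurable_of_tendsto_metrizable (f := fun N v =>
      ∑ n ∈ Finset.range N, 2 * Real.cos (t n * v) * zeroAmplitude (l n) v) (fun N => ?_) ?_
    · refine Finset.measurable_fun_sum _ fun n _ => ?_
      have := measurable_zeroAmplitude (l n)
      fun_prop
    · rw [tendsto_pi_nhds]
      exact fun v => (H.summable_cos_mul_zeroAmplitude v).hasSum.tendsto_sum_nat
  unfold primeDensity
  fun_prop

/-- For `σ > 1`, the product over the zeros is the exponential of minus the Laplace transform of
the corresponding part of the prime density. -/
lemma exp_neg_integral_tsum_zeroAmplitude {s : ℂ} (hs : 1 < s.re) (τ : ℕ → ℝ) :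
    IntegrableOn (fun v : ℝ => ∑' n, Complex.exp (-s * v) *
        (Complex.exp (τ n * Complex.I * v) * (zeroAmplitude (l n) v : ℂ))) (Ioi 0) ∧
      Complex.exp (-∫ v in Ioi (0 : ℝ), ∑' n, Complex.exp (-s * v) *
        (Complex.exp (τ n * Complex.I * v) * (zeroAmplitude (l n) v : ℂ))) =
      zeroProduct l τ s := by
  set F : ℕ → ℝ → ℂ := fun n v => Complex.exp (-s * v) *
    (Complex.exp (τ n * Complex.I * v) * (zeroAmplitude (l n) v : ℂ)) with hF
  set b : ℕ → ℝ → ℝ := fun n v => Real.exp (-s.re * v) * zeroAmplitude (l n) v with hb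
  have hFm : ∀ n, Measurable (F n) := fun n => by
    have := measurable_zeroAmplitude (l n)
    fun_prop
  have hFb : ∀ n v, ‖F n v‖ = b n v := by
    intro n v
    simp only [hF, hb]
    rw [norm_mul, norm_mul, norm_cexp_neg_mul_ofReal, Complex.norm_real,
      Real.norm_of_nonneg (zeroAmplitude_nonneg (H.l_pos n) v)]
    have : (τ n : ℂ) * Complex.I * v = ((τ n * v : ℝ) : ℂ) * Complex.I := by push_cast; ring
    rw [this, Complex.norm_exp_ofReal_mul_I, one_mul]
  have hbs : ∀ v, Summable fun n => b n v := fun v => (H.summable_zeroAmplitude v).mul_left _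
  have hFs : ∀ v, Summable fun n => F n v := fun v =>
    Summable.of_norm_bounded (hbs v) fun n => (hFb n v).le
  have hb0 : ∀ n v, 0 ≤ b n v := fun n v =>
    mul_nonneg (Real.exp_nonneg _) (zeroAmplitude_nonneg (H.l_pos n) v)
  have hdom : IntegrableOn (fun v : ℝ => Real.exp (-(s.re - 1) * v)) (Ioi 0) :=
    integrableOn_exp_mul_Ioi (by linarith) 0
  have hbt : ∀ v, ∑' n, b n v ≤ Real.exp (-(s.re - 1) * v) := by
    intro v
    simp only [hb]
    rw [tsum_mul_left]
    calc Real.exp (-s.re * v) * ∑' n, zeroAmplitude (l n) v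
        ≤ Real.exp (-s.re * v) * Real.exp v := by
          gcongr; exact H.tsum_zeroAmplitude_le_exp v
      _ = _ := by rw [← Real.exp_add]; ring_nf
  have hbm : Measurable fun v => ∑' n, b n v := by
    refine measurable_of_tendsto_metrizable
      (f := fun N v => ∑ n ∈ Finset.range N, b n v) (fun N => ?_) ?_
    · refine Finset.measurable_fun_sum _ fun n _ => ?_
      have := measurable_zeroAmplitude (l n)
      fun_prop
    · rw [tendsto_pi_nhds]
      exact fun v => (hbs v).hasSum.tendsto_sum_nat
  have hbi : IntegrableOn (fun v => ∑' n, b n v) (Ioi 0) :=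
    Integrable.mono' hdom hbm.aestronglyMeasurable (Eventually.of_forall fun v => by
      rw [Real.norm_of_nonneg (tsum_nonneg fun n => hb0 n v)]; exact hbt v)
  have hTm : Measurable fun v => ∑' n, F n v := by
    refine measurable_of_tendsto_metrizable
      (f := fun N v => ∑ n ∈ Finset.range N, F n v)
      (fun N => Finset.measurable_fun_sum _ fun n _ => hFm n) ?_
    rw [tendsto_pi_nhds]
    exact fun v => (hFs v).hasSum.tendsto_sum_nat
  have hTi : IntegrableOn (fun v => ∑' n, F n v) (Ioi 0) :=
    Integrable.mono' hbi hTm.aestronglyMeasurable (Eventually.of_forall fun v =>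
      tsum_of_norm_bounded (hbs v).hasSum fun n => (hFb n v).le)
  refine ⟨hTi, ?_⟩
  have hsum := hasSum_integral_of_dominated_convergence (μ := volume.restrict (Ioi (0 : ℝ)))
    (F := F) (f := fun v => ∑' n, F n v) b (fun n => (hFm n).aestronglyMeasurable)
    (fun n => Eventually.of_forall fun v => (hFb n v).le)
    (Eventually.of_forall hbs) hbi (Eventually.of_forall fun v => (hFs v).hasSum)
  have hprod := hsum.neg.cexp
  rw [← hprod.tprod_eq, zeroProduct]
  refine tprod_congr fun n => ?_
  simp only [Function.comp_apply, hF]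
  rw [integral_zeroAmplitude (H.l_pos n), exp_neg_integral_logKernel, sub_eq_add_neg]
  rw [zeroCoord_re]
  nlinarith [H.l_pos n]

/-- The zeta function built from the prescribed zeros, on the half-plane `σ > 1`. -/
lemma exp_integral_primeDensity {s : ℂ} (hs : 1 < s.re) :
    IntegrableOn (fun v : ℝ => Complex.exp (-s * v) * (primeDensity l t v : ℂ)) (Ioi 0) ∧
      Complex.exp (∫ v in Ioi (0 : ℝ), Complex.exp (-s * v) * (primeDensity l t v : ℂ)) =
        s / (s - 1) * (zeroProduct l t s * zeroProduct l (fun n => -t n) s) := by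
  obtain ⟨hB, hB'⟩ := integral_base_density hs
  obtain ⟨h1, h1'⟩ := H.exp_neg_integral_tsum_zeroAmplitude hs t
  obtain ⟨h2, h2'⟩ := H.exp_neg_integral_tsum_zeroAmplitude hs fun n => -t n
  have hs' : ∀ (τ : ℕ → ℝ) (v : ℝ), Summable fun n => Complex.exp (-s * v) *
      (Complex.exp (τ n * Complex.I * v) * (zeroAmplitude (l n) v : ℂ)) := by
    intro τ v
    refine Summable.mul_left _ (Summable.of_norm_bounded (H.summable_zeroAmplitude v) fun n => ?_)
    have : (τ n : ℂ) * Complex.I * v = ((τ n * v : ℝ) : ℂ) * Complex.I := by push_cast; ring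
    rw [norm_mul, this, Complex.norm_exp_ofReal_mul_I, one_mul, Complex.norm_real,
      Real.norm_of_nonneg (zeroAmplitude_nonneg (H.l_pos n) v)]
  have heq : (fun v : ℝ => Complex.exp (-s * v) * (primeDensity l t v : ℂ)) = fun v : ℝ =>
      Complex.exp (-s * v) * (((Real.exp v - 1) / v : ℝ) : ℂ) -
      ((∑' n, Complex.exp (-s * v) *
        (Complex.exp (t n * Complex.I * v) * (zeroAmplitude (l n) v : ℂ))) +
      ∑' n, Complex.exp (-s * v) *
        (Complex.exp ((-t n : ℝ) * Complex.I * v) * (zeroAmplitude (l n) v : ℂ))) := by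
    funext v
    rw [← (hs' t v).tsum_add (hs' (fun n => -t n) v), primeDensity, Complex.ofReal_sub, mul_sub,
      Complex.ofReal_tsum, ← tsum_mul_left]
    congr 1
    refine tsum_congr fun n => ?_
    push_cast
    rw [Complex.cos]
    ring_nf
  rw [heq]
  refine ⟨hB.sub (h1.add h2), ?_⟩
  have h12 := integral_sub hB (h1.add h2)
  simp only [Pi.add_apply] at h12
  rw [h12, integral_add h1 h2, ← hB', ← h1', ← h2', ← Complex.exp_add,
    ← Complex.exp_add]
  congr 1
  ring

lemma integral_primeMeasure (s : ℂ) :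
    ∫ x : ℝ, (x : ℂ) ^ (-s) ∂(primeMeasure l t) =
      ∫ v in Ioi (0 : ℝ), Complex.exp (-s * v) * (primeDensity l t v : ℂ) := by
  have hm : Measurable fun v => ENNReal.ofReal (primeDensity l t v) :=
    H.measurable_primeDensity.ennreal_ofReal
  rw [primeMeasure, integral_map Real.measurable_exp.aemeasurable
    (Complex.measurable_ofReal.pow_const _).aestronglyMeasurable,
    integral_withDensity_eq_integral_toReal_smul hm
      (Eventually.of_forall fun _ => ENNReal.ofReal_lt_top)]
  refine setIntegral_congr_fun measurableSet_Ioi fun v (hv : 0 < v) => ?_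
  rw [ENNReal.toReal_ofReal (H.primeDensity_nonneg hv), Complex.real_smul, Complex.ofReal_exp,
    Complex.cpow_def_of_ne_zero (Complex.exp_ne_zero _), ← Complex.ofReal_exp,
    ← Complex.ofReal_log (Real.exp_nonneg _), Real.log_exp, mul_comm (v : ℂ), mul_comm]

lemma lintegral_primeMeasure_ne_top {σ : ℝ} (hσ : 1 < σ) :
    ∫⁻ x, ENNReal.ofReal (x ^ (-σ)) ∂(primeMeasure l t) ≠ ⊤ := by
  have hm : Measurable fun v => ENNReal.ofReal (primeDensity l t v) :=
    H.measurable_primeDensity.ennreal_ofReal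
  have hp : Measurable fun x : ℝ => ENNReal.ofReal (x ^ (-σ)) := by fun_prop
  rw [primeMeasure, lintegral_map hp Real.measurable_exp,
    lintegral_withDensity_eq_lintegral_mul _ hm
      (g := fun v => ENNReal.ofReal (Real.exp v ^ (-σ))) (hp.comp Real.measurable_exp)]
  have h := (H.exp_integral_primeDensity (s := (σ : ℂ)) (by simpa using hσ)).1.2
  rw [HasFiniteIntegral] at h
  refine ne_top_of_le_ne_top h.ne (le_of_eq ?_)
  refine setLIntegral_congr_fun measurableSet_Ioi fun v (hv : 0 < v) => ?_
  rw [Pi.mul_apply, ← ofReal_norm, norm_mul, norm_cexp_neg_mul_ofReal, Complex.norm_real,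
    Real.norm_of_nonneg (H.primeDensity_nonneg hv), ← ENNReal.ofReal_mul (H.primeDensity_nonneg hv),
    ← Real.exp_mul, Complex.ofReal_re, mul_comm v, mul_comm]

/-- For sparse data there is a Beurling system whose zeta function is, for `σ > 1`, the product of
`s / (s - 1)` and of the products over the prescribed zeros and over their conjugates. -/
theorem exists_system :
    ∃ B : ExtendedBeurlingSystem, B.primeFn.measure (Iio 1) = 0 ∧
      MellinStieltjesConvergent B.primeFn.measure ∧ MellinStieltjesConvergent B.intFn.measure ∧
      ∀ s : ℂ, 1 < s.re →
        s / (s - 1) * (zeroProduct l t s * zeroProduct l (fun n => -t n) s) =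
          Complex.exp (mellinStieltjes B.primeFn.measure s) ∧
        B.zeta s = Complex.exp (mellinStieltjes B.primeFn.measure s) := by
  have hsf : SFinite (primeMeasure l t) := by unfold primeMeasure; infer_instance
  have h1 : primeMeasure l t (Iic 1) = 0 := primeMeasure_Iic_one l t
  have h1' : primeMeasure l t (Iio 1) = 0 := measure_mono_null Iio_subset_Iic_self h1
  obtain ⟨B, hB, hc1, hc2, hz⟩ := exists_extendedBeurlingSystem (primeMeasure l t) h1
    fun σ hσ => H.lintegral_primeMeasure_ne_top hσ
  refine ⟨B, by rw [hB, h1'], by rw [hB]; exact hc1, hc2, fun s hs => ⟨?_, by rw [hB, hz s hs]⟩⟩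
  rw [hB, mellinStieltjes, restrict_Ici_one_eq h1', H.integral_primeMeasure,
    (H.exp_integral_primeDensity hs).2]

end IsSparse

/-! ### The continued zeta function -/

/-- The analytic continuation of the zeta function: a pole at `1` and the prescribed zeros
together with their conjugates. -/
noncomputable def continuedZeta (l t : ℕ → ℝ) (s : ℂ) : ℂ :=
  s / (s - 1) * (zeroProduct l t s * zeroProduct l (fun n => -t n) s)

namespace IsSparse

variable {l t : ℕ → ℝ} (H : IsSparse l t)

include H

lemma abs_t (n : ℕ) : |t n| = t n := abs_of_pos (H.t_pos n)

lemma abs_neg_t (n : ℕ) : |(-t n)| = t n := by rw [abs_neg, H.abs_t]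

lemma differentiableOn_zeroProducts :
    DifferentiableOn ℂ (fun s => zeroProduct l t s * zeroProduct l (fun n => -t n) s)
      {s | -1 < s.re} :=
  (H.differentiableOn_zeroProduct H.abs_t).mul (H.differentiableOn_zeroProduct H.abs_neg_t)

lemma analyticOnNhd_continuedZeta :
    AnalyticOnNhd ℂ (continuedZeta l t) ({s | -1 < s.re} \ {1}) := by
  have ho : IsOpen ({s : ℂ | -1 < s.re} \ {1}) :=
    (isOpen_lt continuous_const Complex.continuous_re).sdiff isClosed_singleton
  refine DifferentiableOn.analyticOnNhd ?_ ho
  refine DifferentiableOn.mul ?_ (H.differentiableOn_zeroProducts.mono sdiff_subset)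
  intro s hs
  have h1 : s - 1 ≠ 0 := sub_ne_zero.2 hs.2
  exact (differentiableAt_fun_id.fun_div (differentiableAt_fun_id.sub_const (1 : ℂ))
    h1).differentiableWithinAt

lemma meromorphicOrderAt_continuedZeta : meromorphicOrderAt (continuedZeta l t) 1 = -1 := by
  have ho : IsOpen {s : ℂ | -1 < s.re} := isOpen_lt continuous_const Complex.continuous_re
  have h1 : (1 : ℂ) ∈ {s : ℂ | -1 < s.re} := by simp
  have hP : AnalyticAt ℂ (fun s => zeroProduct l t s * zeroProduct l (fun n => -t n) s) 1 :=
    H.differentiableOn_zeroProducts.analyticAt (ho.mem_nhds h1)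
  have hsub : AnalyticAt ℂ (fun s : ℂ => s - 1) 1 := analyticAt_id.sub analyticAt_const
  have hmer : MeromorphicAt (continuedZeta l t) 1 :=
    (analyticAt_id.meromorphicAt.div hsub.meromorphicAt).mul hP.meromorphicAt
  refine (meromorphicOrderAt_eq_int_iff (n := -1) hmer).2
    ⟨_, analyticAt_id.mul hP, ?_, Eventually.of_forall fun s => ?_⟩
  · simp only [Pi.mul_apply, id, one_mul]
    exact mul_ne_zero (H.zeroProduct_ne_zero H.abs_t (by simp))
      (H.zeroProduct_ne_zero H.abs_neg_t (by simp))
  · simp only [continuedZeta, Pi.mul_apply, id, smul_eq_mul, zpow_neg, zpow_one]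
    ring

/-- The growth of the continued zeta function to the left of `σ = 1`. Only a factor with a zero at
a comparable height matters, and it is at most `1 + e^{2 l n / φ}`, which is `O(e^φ)` as soon as
`2 l n ≤ φ²`. -/
lemma norm_continuedZeta_le {φ : ℝ → ℝ} (hφ : ∀ y, 0 ≤ y → 1 ≤ φ y)
    (hl : ∀ n y, t n ≤ 2 * y → 2 * l n ≤ φ y ^ 2) {s : ℂ} (him : 1 ≤ s.im)
    (hre : 1 - 1 / φ s.im ≤ s.re) :
    ‖continuedZeta l t s‖ ≤
      2 * (5 * Real.exp (16 / 3) * (5 * Real.exp (16 / 3))) * Real.exp (φ s.im) := by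
  set y := s.im with hy
  have hφ1 := hφ y (by linarith)
  have hφinv : 1 / φ y ≤ 1 := by rw [div_le_one (by linarith)]; exact hφ1
  have hre0 : 0 ≤ s.re := by linarith
  have hexp1 : 1 ≤ Real.exp (φ y) := Real.one_le_exp (by linarith)
  have hgeo : ∀ n : ℕ, 4 * (1 / 4 : ℝ) ^ n ≤ 4 := fun n => by
    have := pow_le_one₀ (n := n) (by norm_num : (0 : ℝ) ≤ 1 / 4) (by norm_num)
    linarith
  have h1 : ‖zeroProduct l t s‖ ≤ 5 * Real.exp (φ y) * Real.exp (16 / 3) := by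
    obtain ⟨k, hk⟩ := H.exists_far y
    refine H.norm_zeroProduct_le H.abs_t hre0 (k := k) ?_ hk
    rcases le_or_gt (t k / 2) |y - t k| with h | h
    · have := H.norm_blockTransform_far (τ := t) (by linarith : -1 ≤ s.re) h
      linarith [hgeo k]
    · have hlk := H.l_pos k
      rw [abs_lt] at h
      have h2 := hl k y (by linarith [h.1])
      have h3 := norm_blockTransform_le (a := l k / φ y) (z := zeroCoord (l k) (t k) s)
        (by positivity) (by
          rw [zeroCoord_re]
          have h4 := mul_le_mul_of_nonneg_left hre hlk.le
          have h5 : l k * (1 - 1 / φ y) = l k - l k / φ y := by ring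
          linarith)
      have h6 : Real.exp (2 * (l k / φ y)) ≤ Real.exp (φ y) := by
        rw [Real.exp_le_exp, mul_div_assoc', div_le_iff₀ (by linarith)]
        linarith [sq (φ y)]
      linarith
  have h2 : ‖zeroProduct l (fun n => -t n) s‖ ≤ 5 * Real.exp (16 / 3) := by
    have hfar : ∀ n, t n / 2 ≤ |s.im - (fun n => -t n) n| := fun n => by
      have := H.t_pos n
      rw [sub_neg_eq_add, abs_of_pos (by linarith)]
      linarith
    refine H.norm_zeroProduct_le H.abs_neg_t hre0 (k := 0) ?_ fun n _ => hfar n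
    have := H.norm_blockTransform_far (τ := fun n => -t n) (by linarith : -1 ≤ s.re) (hfar 0)
    linarith [hgeo 0]
  have hs1 : 1 ≤ ‖s - 1‖ := by
    refine le_trans ?_ (Complex.abs_im_le_norm _)
    simp only [Complex.sub_im, Complex.one_im, sub_zero]
    exact him.trans (le_abs_self _)
  have h3 : ‖s / (s - 1)‖ ≤ 2 := by
    rw [norm_div, div_le_iff₀ (by linarith)]
    have := norm_add_le (s - 1) 1
    rw [sub_add_cancel, norm_one] at this
    linarith
  rw [continuedZeta, norm_mul, norm_mul]
  calc ‖s / (s - 1)‖ * (‖zeroProduct l t s‖ * ‖zeroProduct l (fun n => -t n) s‖)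
      ≤ 2 * (5 * Real.exp (φ y) * Real.exp (16 / 3) * (5 * Real.exp (16 / 3))) := by gcongr
    _ = _ := by ring

lemma continuedZeta_eq_zero (k : ℕ) :
    continuedZeta l t (1 - (1 / l k : ℝ) + t k * Complex.I) = 0 := by
  rw [continuedZeta, H.zeroProduct_eq_zero k, zero_mul, mul_zero]

lemma tendsto_t : Tendsto t atTop atTop :=
  tendsto_atTop_mono H.pow_le (tendsto_pow_atTop_atTop_of_one_lt (by norm_num))

end IsSparse

/-- A sparse sequence of heights can be chosen inside every neighbourhood of infinity. -/
lemma exists_isSparse {L : ℝ → ℝ} (hL : Tendsto L atTop atTop)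
    (hlog : ∀ᶠ y in atTop, 8 * L y ≤ Real.log y) {P : ℝ → Prop} (hP : ∀ᶠ y in atTop, P y) :
    ∃ t : ℕ → ℝ, IsSparse (fun n => L (t n)) t ∧ ∀ n, P (t n) := by
  obtain ⟨y₀, hy₀, hy₀', hy₀'', hy₀'''⟩ := (hP.and (hlog.and
    ((hL.eventually_ge_atTop 10).and (eventually_ge_atTop 1)))).exists
  have step : ∀ (n : ℕ) (x : ℝ), ∃ y, P y ∧ 8 * L y ≤ Real.log y ∧
      100 * ((n : ℝ) + 2) * L x ≤ L y ∧ 16 ^ (n + 1) ≤ y ∧ 4 * x ≤ y := fun n x =>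
    (hP.and (hlog.and ((hL.eventually_ge_atTop _).and
      ((eventually_ge_atTop _).and (eventually_ge_atTop _))))).exists
  choose next h1 h2 h3 h4 h5 using step
  refine ⟨fun n => Nat.rec y₀ (fun n x => next n x) n, ⟨hy₀'', fun n => h3 n _, fun n => ?_,
    fun n => h5 n _, fun n => ?_⟩, fun n => ?_⟩
  · cases n with
    | zero => simpa using hy₀'''
    | succ n => exact h4 n _
  · cases n with
    | zero => exact hy₀'
    | succ n => exact h2 n _
  · cases n with
    | zero => exact hy₀
    | succ n => exact h1 n _

/-! ### The function `f` -/

lemma exists_antitoneOn_pos {f : ℝ → ℝ} (hf : EventuallyNice f) (hf0 : Tendsto f atTop (𝓝 0))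
    (hfu : (fun u : ℝ => 1 / u) =o[atTop] f) :
    ∃ U : ℝ, AntitoneOn f (Ici U) ∧ ∀ u, U ≤ u → 0 < f u := by
  obtain ⟨U, _, hanti, _⟩ := hf
  have h1 := hfu.bound one_pos
  obtain ⟨V, hV⟩ := eventually_atTop.1 (h1.and (eventually_gt_atTop 0))
  refine ⟨max U V, hanti.mono (Ici_subset_Ici.2 (le_max_left _ _)), fun u hu => ?_⟩
  obtain ⟨h2, h3⟩ := hV u ((le_max_right _ _).trans hu)
  have hne : f u ≠ 0 := by
    intro h
    rw [h, norm_zero, mul_zero, norm_le_zero_iff] at h2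
    exact (one_div_pos.2 h3).ne' h2
  have hU : U ≤ u := (le_max_left _ _).trans hu
  refine lt_of_le_of_ne (le_of_tendsto hf0 ?_) hne.symm
  filter_upwards [eventually_ge_atTop u] with x hx
  exact hanti hU (hU.trans hx) hx

/-- Since `log (4 t + 2) ≤ (1 + δ) log t` for every `δ > 0` and all large `t`, regular variation
gives `f (log (4 t + 2)) ~ f (log t)`. -/
lemma tendsto_ratio {f : ℝ → ℝ} {U α : ℝ} (hanti : AntitoneOn f (Ici U))
    (hpos : ∀ u, U ≤ u → 0 < f u) (hvar : RegularlyVarying f (-α)) :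
    Tendsto (fun y => f (Real.log (4 * y + 2)) / f (Real.log y)) atTop (𝓝 1) := by
  have hlogU : ∀ᶠ y in atTop, U ≤ Real.log y := Real.tendsto_log_atTop.eventually_ge_atTop U
  refine tendsto_order.2 ⟨fun a ha => ?_, fun a ha => ?_⟩
  · -- by continuity of `l ↦ l ^ (-α)` at `1`, some `l > 1` has `a < l ^ (-α)`
    obtain ⟨l, hl1, hl⟩ : ∃ l : ℝ, 1 < l ∧ a < l ^ (-α) := by
      have hc : Tendsto (fun l : ℝ => l ^ (-α)) (𝓝[>] 1) (𝓝 1) := by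
        have := (Real.continuousAt_rpow_const 1 (-α) (Or.inl one_ne_zero)).tendsto
        rw [Real.one_rpow] at this
        exact this.mono_left nhdsWithin_le_nhds
      obtain ⟨l, h1, h2⟩ := ((hc.eventually_const_lt ha).and self_mem_nhdsWithin).exists
      exact ⟨l, h2, h1⟩
    have h1 := (hvar l (by linarith)).comp Real.tendsto_log_atTop
    have h2 := Real.tendsto_log_atTop.eventually_ge_atTop (Real.log 6 / (l - 1))
    filter_upwards [h1.eventually_const_lt hl, h2, hlogU, eventually_ge_atTop 1]
      with y hy1 hy2 hy3 hy4
    refine lt_of_lt_of_le hy1 ?_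
    have h3 : Real.log (4 * y + 2) ≤ l * Real.log y := by
      have h4 : Real.log (4 * y + 2) ≤ Real.log (6 * y) :=
        Real.log_le_log (by linarith) (by linarith)
      rw [Real.log_mul (by norm_num) (by linarith)] at h4
      rw [div_le_iff₀ (by linarith)] at hy2
      linarith
    have h5 : Real.log y ≤ Real.log (4 * y + 2) := Real.log_le_log (by linarith) (by linarith)
    have := (hpos _ hy3).le
    simp only [Function.comp_apply]
    gcongr
    exact hanti (hy3.trans h5) ((hy3.trans h5).trans h3) h3
  · filter_upwards [hlogU, eventually_ge_atTop 1] with y hy hy1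
    refine lt_of_le_of_lt ?_ ha
    have h5 : Real.log y ≤ Real.log (4 * y + 2) := Real.log_le_log (by linarith) (by linarith)
    rw [div_le_one (hpos _ hy)]
    exact hanti hy (hy.trans h5) h5

theorem mainTheorem5 (f : ℝ → ℝ)
    (hf : EventuallyNice f)
    (hf0 : Tendsto f atTop (𝓝 0))
    (hfu : (fun u : ℝ => 1 / u) =o[atTop] f)
    (hvar : (∃ α : ℝ, 0 < α ∧ α ≤ 1 ∧ RegularlyVarying f (-α)) ∨
      (SlowlyVarying f ∧ DerivDecrease f)) :
    ∃ (B : ExtendedBeurlingSystem) (Z : ℂ → ℂ) (φ ψ : ℝ → ℝ) (t₀ : ℝ),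
      -- the zeta function of `B` converges for `σ > 1`, where it equals `Z`
      MellinStieltjesConvergent B.intFn.measure ∧
      (∀ s : ℂ, 1 < s.re → Z s = B.zeta s) ∧
      -- the conditions of the Hauptsatz, including the continuation and the growth bound
      LandauHypotheses B.primeFn.measure Z φ ψ t₀ ∧
      -- infinitely many zeros, of arbitrarily large height, with `σ ≥ 1 - f(log t)`
      (∀ T : ℝ, {s : ℂ | s ∈ landauRegion ψ ∧ T ≤ s.im ∧
        1 - f (Real.log s.im) ≤ s.re ∧ Z s = 0}.Infinite) ∧
      -- the lower bound for the width of Landau's region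
      (∃ ε : ℝ → ℝ, Tendsto ε atTop (𝓝 0) ∧ ∀ᶠ t in atTop,
        f (Real.log t) / (2 + ε t) ≤ 1 / (ψ (2 * t + 1) * φ (2 * t + 1))) ∧
      -- hence sharpness of the Hauptsatz up to the constant
      (∀ c : ℝ, 2 < c → ¬ LandauAdmissible Z φ ψ c) := by
  obtain ⟨U, hanti, hpos⟩ := exists_antitoneOn_pos hf hf0 hfu
  have hratio : Tendsto (fun y => f (Real.log (4 * y + 2)) / f (Real.log y)) atTop (𝓝 1) := by
    rcases hvar with ⟨α, -, -, h⟩ | ⟨h, -⟩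
    · exact tendsto_ratio hanti hpos h
    · exact tendsto_ratio (α := 0) hanti hpos fun l hl => by simpa using h l hl
  have hflog : Tendsto (fun y => f (Real.log y)) atTop (𝓝 0) := hf0.comp Real.tendsto_log_atTop
  have hlogU : ∀ᶠ y in atTop, U ≤ Real.log y := Real.tendsto_log_atTop.eventually_ge_atTop U
  obtain ⟨t₁, ht₁⟩ := eventually_atTop.1 ((eventually_ge_atTop 1).and
    (hlogU.and (hflog.eventually_le_const (by norm_num : (0 : ℝ) < 1 / 4))))
  have ht₁1 : 1 ≤ t₁ := (ht₁ t₁ le_rfl).1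
  have hflog_anti : ∀ x y, t₁ ≤ x → x ≤ y → f (Real.log y) ≤ f (Real.log x) := fun x y hx hxy =>
    hanti (ht₁ x hx).2.1 (ht₁ y (hx.trans hxy)).2.1
      (Real.log_le_log (by linarith) hxy)
  have hflog_pos : ∀ y, t₁ ≤ y → 0 < f (Real.log y) := fun y hy => hpos _ (ht₁ y hy).2.1
  -- the common choice of `φ` and `ψ`, with `φ ψ = 2 / f (log 2t)` for large `t`
  set φ : ℝ → ℝ := fun y => √(2 / f (Real.log (2 * max y t₁))) with hφdef
  have harg : ∀ y, t₁ ≤ 2 * max y t₁ := fun y => by linarith [le_max_right y t₁]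
  have hφ1 : ∀ y, 1 ≤ φ y := fun y => by
    rw [hφdef, Real.one_le_sqrt, one_le_div (hflog_pos _ (harg y))]
    linarith [(ht₁ _ (harg y)).2.2]
  have hφsq : ∀ y, t₁ ≤ y → φ y ^ 2 = 2 / f (Real.log (2 * y)) := fun y hy => by
    have := hflog_pos _ (harg y)
    rw [hφdef, Real.sq_sqrt (by positivity), max_eq_left hy]
  have hφmono : Monotone φ := fun x y hxy => by
    have := hflog_pos _ (harg y)
    refine Real.sqrt_le_sqrt ?_
    gcongr
    exact hflog_anti _ _ (harg x) (by gcongr)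
  have hφtop : Tendsto φ atTop atTop := by
    have h1 : Tendsto (fun y => f (Real.log (2 * max y t₁))) atTop (𝓝[>] 0) := by
      refine tendsto_nhdsWithin_iff.2 ⟨hflog.comp (tendsto_atTop_mono (fun y => ?_) tendsto_id),
        Eventually.of_forall fun y => hflog_pos _ (harg y)⟩
      simp only [id]
      linarith [le_max_left y t₁, le_max_right y t₁]
    refine Real.tendsto_sqrt_atTop.comp ?_
    exact h1.inv_tendsto_nhdsGT_zero.const_mul_atTop (zero_lt_two (α := ℝ))
  -- the reciprocals of the distances of the zeros to the line `σ = 1`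
  set L : ℝ → ℝ := fun y => 1 / f (Real.log y) with hLdef
  have hLtop : Tendsto L atTop atTop := by
    have h1 : Tendsto (fun y => f (Real.log y)) atTop (𝓝[>] 0) :=
      tendsto_nhdsWithin_iff.2 ⟨hflog, (eventually_ge_atTop t₁).mono hflog_pos⟩
    simp only [hLdef, one_div]
    exact h1.inv_tendsto_nhdsGT_zero
  have hLlog : ∀ᶠ y in atTop, 8 * L y ≤ Real.log y := by
    have h1 := Real.tendsto_log_atTop.eventually (hfu.bound (by norm_num : (0 : ℝ) < 1 / 8))
    filter_upwards [h1, eventually_ge_atTop t₁, Real.tendsto_log_atTop.eventually_gt_atTop 0]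
      with y hy hy1 hy2
    have hfy := hflog_pos y hy1
    rw [Real.norm_of_nonneg (by positivity), Real.norm_of_nonneg hfy.le, div_le_iff₀ hy2] at hy
    rw [hLdef]
    simp only
    rw [mul_one_div, div_le_iff₀ hfy]
    linarith
  have hregion : ∀ᶠ y in atTop, t₁ ≤ y / 2 ∧ f (Real.log y) ≤ 1 / φ y := by
    filter_upwards [hratio.eventually_const_lt (by norm_num : (1 / 2 : ℝ) < 1),
      eventually_ge_atTop (2 * t₁)] with y hy hy1
    refine ⟨by linarith, ?_⟩
    have hy2 : t₁ ≤ y := by linarith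
    have hfy := hflog_pos y hy2
    have hf2 := hflog_pos (2 * y) (by linarith)
    have hq := (ht₁ y hy2).2.2
    have h4 := hflog_anti (2 * y) (4 * y + 2) (by linarith) (by linarith)
    rw [lt_div_iff₀ hfy] at hy
    rw [le_div_iff₀ (by linarith [hφ1 y])]
    refine abs_le_one_iff_mul_self_le_one.2 ?_ |> (le_abs_self _).trans
    calc f (Real.log y) * φ y * (f (Real.log y) * φ y)
        = f (Real.log y) ^ 2 * φ y ^ 2 := by ring
      _ = f (Real.log y) ^ 2 * 2 / f (Real.log (2 * y)) := by rw [hφsq y hy2]; ring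
      _ ≤ 1 := by rw [div_le_one hf2]; nlinarith
  obtain ⟨t, H, ht⟩ := exists_isSparse hLtop hLlog hregion
  have hlφ : ∀ n y, t n ≤ 2 * y → 2 * L (t n) ≤ φ y ^ 2 := by
    intro n y hny
    have h1 := (ht n).1
    rw [hφsq y (by linarith), hLdef, mul_one_div]
    have := hflog_pos (2 * y) (by linarith)
    gcongr
    exact hflog_anti _ _ (by linarith) hny
  obtain ⟨B, hB0, hB1, hB2, hB3⟩ := H.exists_system
  -- the zeros lie in Landau's region
  have hzero : ∀ n, ∃ s : ℂ, s ∈ landauRegion φ ∧ s.im = t n ∧ s.re = 1 - f (Real.log (t n)) ∧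
      continuedZeta (fun n => L (t n)) t s = 0 := by
    intro n
    refine ⟨_, ?_, ?_, ?_, H.continuedZeta_eq_zero n⟩
    · have := (ht n).2
      simp only [landauRegion, mem_ofPred_eq, Complex.add_im, Complex.sub_im, Complex.one_im,
        Complex.ofReal_im, Complex.mul_im, Complex.ofReal_re, Complex.I_im, Complex.I_re,
        Complex.add_re, Complex.sub_re, Complex.one_re, Complex.mul_re]
      simp only [hLdef, one_div_one_div, mul_one, mul_zero, sub_zero, zero_add, add_zero]
      rw [abs_of_pos (H.t_pos n)]
      linarith
    · simp
    · simp [hLdef]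
  have hwidth : ∀ᶠ y in atTop, f (Real.log y) /
      (2 + (2 * (f (Real.log (4 * y + 2)) / f (Real.log y))⁻¹ - 2)) ≤
        1 / (φ (2 * y + 1) * φ (2 * y + 1)) := by
    filter_upwards [eventually_ge_atTop t₁] with y hy
    have hfy := hflog_pos y hy
    have hf4 := hflog_pos (4 * y + 2) (by linarith)
    rw [← sq, hφsq _ (by linarith), show 2 * (2 * y + 1) = 4 * y + 2 by ring]
    rw [add_sub_cancel, inv_div, div_div_eq_mul_div,
      div_le_div_iff₀ (by positivity) (by positivity)]
    refine le_of_eq ?_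
    field_simp
  have hε : Tendsto (fun y => 2 * (f (Real.log (4 * y + 2)) / f (Real.log y))⁻¹ - 2) atTop
      (𝓝 0) := by
    have := ((hratio.inv₀ one_ne_zero).const_mul 2).sub_const 2
    simpa using this
  refine ⟨B, continuedZeta (fun n => L (t n)) t, φ, φ, 1, hB2, fun s hs => ?_, ?_, fun T => ?_,
    ⟨_, hε, hwidth⟩, fun c hc => ?_⟩
  · rw [(hB3 s hs).2, ← (hB3 s hs).1, continuedZeta]
  · exact {
      t₀_pos := one_pos
      φ_mono := hφmono.monotoneOn _
      φ_pos := fun y _ => zero_lt_one.trans_le (hφ1 y)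
      φ_tendsto := hφtop
      ψ_mono := hφmono.monotoneOn _
      one_le_ψ := fun y _ => hφ1 y
      ψ_bound := ⟨1, fun y _ => by linarith [Real.add_one_le_exp (φ y)]⟩
      m_support := hB0
      m_convergent := hB1
      F_eq_exp := fun s hs => (hB3 s hs).1
      F_analytic := H.analyticOnNhd_continuedZeta.mono (by
        refine sdiff_subset_sdiff_left fun s (hs : 1 - 1 / φ |s.im| ≤ s.re) => ?_
        have h1 : 1 / φ |s.im| ≤ 1 := by
          rw [div_le_one (by linarith [hφ1 |s.im|])]; exact hφ1 _
        change -1 < s.re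
        linarith)
      F_pole := H.meromorphicOrderAt_continuedZeta
      F_bound := ⟨_, fun s h1 h2 => H.norm_continuedZeta_le (fun y _ => hφ1 y) hlφ h1 h2⟩ }
  · intro hfin
    obtain ⟨M, hM⟩ := (hfin.image Complex.im).bddAbove
    obtain ⟨n, hn1, hn2⟩ := (H.tendsto_t.eventually ((eventually_ge_atTop T).and
      (eventually_gt_atTop M))).exists
    obtain ⟨s, hs1, hs2, hs3, hs4⟩ := hzero n
    have := hM (mem_image_of_mem Complex.im ⟨hs1, by rw [hs2]; exact hn1, by rw [hs2, hs3], hs4⟩)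
    rw [hs2] at this
    linarith
  · rintro ⟨T, hT⟩
    obtain ⟨n, hn1, hn2, hn3, hn4⟩ := (H.tendsto_t.eventually ((eventually_ge_atTop T).and
      (hwidth.and ((hε.eventually_lt_const (by linarith : (0 : ℝ) < c - 2)).and
        (hε.eventually_const_lt (by norm_num : (-1 : ℝ) < 0)))))).exists
    obtain ⟨s, hs1, hs2, hs3, hs4⟩ := hzero n
    refine hT s hs1 (by rw [hs2]; exact hn1) ?_ hs4
    rw [hs2, hs3]
    have hfn := hflog_pos (t n) (by linarith [(ht n).1])
    have hφn := hφ1 (2 * t n + 1)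
    have h1 : f (Real.log (t n)) / c ≤ 1 / (φ (2 * t n + 1) * φ (2 * t n + 1)) := by
      refine le_trans ?_ hn2
      gcongr
      · linarith
      · linarith
    rw [div_le_iff₀ (by linarith)] at h1
    have h2 : 1 / (φ (2 * t n + 1) * φ (2 * t n + 1)) * c =
        c / (φ (2 * t n + 1) * φ (2 * t n + 1)) := by ring
    linarith
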